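/- Let $n\ge 2$ and $m\ge 1$. Let $V=\{a\in\mathbb R^n:\sum_i a_i=0\}$ with the standard inner product, let $\varepsilon_1,\dots,\varepsilon_n$ be the standard basis of $\mathbb R^n$, let $\Delta^+=\{\varepsilon_i-\varepsilon_j: i<j\}$ be the positive roots, $\alpha_i=\varepsilon_i-\varepsilon_{i+1}$ $(1\le i<n)$ the simple roots, $\theta=\varepsilon_1-\varepsilon_n$ the highest root, and $H_{\alpha,k}=\{v\in V:\langle v,\alpha\rangle=k\}$. Regions of the $m$-Shi arrangement are the connected components of the complement in $V$ of all $H_{\alpha,k}$ with $\alpha\in\Delta^+$, $-m<k\le m$; alcoves are the connected components of the complement of all $H_{\alpha,k}$ with $\alpha\in\Delta^+$, $k\in\mathbb Z$. The fundamental alcove $\mathcal A_0$ is the interior of $\{v:\langle v,\theta\rangle\le 1,\ \langle v,\alpha_i\rangle\ge 0 \text{ for all } i\}$. A region is dominant if it is contained in $\{v:\langle v,\alpha_i\rangle\ge0\text{ for all }i\}$. The $m$-minimal alcove of a region is the alcove contained in it that is closest to $\mathcal A_0$, i.e. separated from $\mathcal A_0$ by the fewest hyperplanes $H_{\alpha,k}$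 $(\alpha\in\Delta^+,\ k\in\mathbb Z)$. A separating wall of a region $R$ is a hyperplane of the $m$-Shi arrangement that supports a facet of $R$ and separates $R$ from $\mathcal A_0$. Let $\widehat{\mathfrak S}_n=\langle s_0,\dots,s_{n-1}\rangle$ be the affine symmetric group (the Coxeter group of type $\widetilde A_{n-1}$) and $\mathfrak S_n=\langle s_1,\dots,s_{n-1}\rangle$. It acts on $V$: $s_i$ $(i\neq0)$ is the reflection in $H_{\alpha_i,0}$ and $s_0$ the reflection in $H_{\theta,1}$. It acts on $n$-cores (partitions none of whose hook lengths is divisible by $n$): the box in row $i$ and column $j$ has residue $j-i \bmod n$, and $s_r$ adds all addable boxes of residue $r$ if there are any, removes all removable boxes of residue $r$ if there are any, and otherwise fixes the core. Let $\Phi$ be the bijection from $n$-cores to dominant alcoves given by $\Phi(w\emptyset)=w^{-1}\mathcal A_0$ for $w\in\widehat{\mathfrak S}_n$ of minimal length in its coset $w\mathfrak S_n$. Let $R$ be a dominant region of the $m$-Shi arrangement with $m$-minimal alcove $\mathcal A$, and let $\lambda$ be the $n$-core with $\Phi(\lambda)=\mathcal A$. Then $H_{\theta,m}$ is a separating wall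 of $R$ if and only if $h_{11}^{\lambda}=n(m-1)+1$, where $h_{11}^\lambda$ is the hook length of the box in the first row and first column of $\lambda$ (for $\lambda=\emptyset$ the equality is regarded as false). -/

import Mathlib

namespace ShiCore

noncomputable section

/-! ### The space `V`, roots and hyperplanes

Coordinates are indexed by `Fin n`, i.e. by `0, …, n - 1`; arithmetic on `Fin n` is modulo `n`, so
`-1 : Fin n` is the last index. -/

/-- `V = {(a₁, …, aₙ) ∈ ℝⁿ : a₁ + ⋯ + aₙ = 0}`, with the inner product of Euclidean space. -/
def V (n : ℕ) : Submodule ℝ (EuclideanSpace ℝ (Fin n)) where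
  carrier := {v | ∑ i, v i = 0}
  zero_mem' := by simp
  add_mem' := by
    intro a b ha hb
    simp only [Set.mem_ofPred_eq, PiLp.add_apply, Finset.sum_add_distrib] at *
    rw [ha, hb, add_zero]
  smul_mem' := by
    intro c a ha
    simp only [Set.mem_ofPred_eq, PiLp.smul_apply, smul_eq_mul, ← Finset.mul_sum] at *
    rw [ha, mul_zero]

/-- The vector `eᵢ - eⱼ` of `V`. -/
def root {n : ℕ} (i j : Fin n) : V n :=
  ⟨EuclideanSpace.single i (1 : ℝ) - EuclideanSpace.single j (1 : ℝ), by
    change ∑ k, (EuclideanSpace.single i (1 : ℝ) - EuclideanSpace.single j (1 : ℝ) :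
      EuclideanSpace ℝ (Fin n)) k = 0
    simp⟩

/-- The positive roots `eᵢ - eⱼ`, `i < j`. -/
def posRoots (n : ℕ) : Set (V n) := {α | ∃ i j : Fin n, i < j ∧ α = root i j}

/-- For `i ≠ 0` the simple root `αᵢ`; for `i = 0` the vector `-θ`. -/
def simpleRoot {n : ℕ} [NeZero n] (i : Fin n) : V n := root (i - 1) i

/-- The highest root `θ = e₁ - eₙ`. -/
def theta (n : ℕ) [NeZero n] : V n := root 0 (-1)

/-- The hyperplane `{v ∈ V : ⟨v, α⟩ = k}`. -/
def hyperplane {n : ℕ} (α : V n) (k : ℤ) : Set (V n) := {v | inner ℝ v α = (k : ℝ)}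

/-- The closed half-space `{v ∈ V : ⟨v, α⟩ ≥ k}`. -/
def halfPos {n : ℕ} (α : V n) (k : ℤ) : Set (V n) := {v | (k : ℝ) ≤ inner ℝ v α}

/-- The closed half-space `{v ∈ V : ⟨v, α⟩ ≤ k}`. -/
def halfNeg {n : ℕ} (α : V n) (k : ℤ) : Set (V n) := {v | inner ℝ v α ≤ (k : ℝ)}

/-! ### Arrangements, regions, alcoves, walls -/

/-- The `m`-Shi arrangement: all hyperplanes `⟨v, α⟩ = k` with `α > 0` and `-m < k ≤ m`. -/
def shiArrangement (n m : ℕ) : Set (Set (V n)) :=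
  {H | ∃ α ∈ posRoots n, ∃ k : ℤ, -(m : ℤ) < k ∧ k ≤ (m : ℤ) ∧ H = hyperplane α k}

/-- The affine arrangement: all hyperplanes `⟨v, α⟩ = k` with `α > 0` and `k ∈ ℤ`. -/
def affineArrangement (n : ℕ) : Set (Set (V n)) :=
  {H | ∃ α ∈ posRoots n, ∃ k : ℤ, H = hyperplane α k}

/-- `R` is a connected component of the complement of the arrangement `𝓗`. -/
def IsRegion {n : ℕ} (𝓗 : Set (Set (V n))) (R : Set (V n)) : Prop :=
  ∃ x ∈ (⋃₀ 𝓗)ᶜ, R = connectedComponentIn (⋃₀ 𝓗)ᶜ x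

/-- The (closed) dominant chamber `⋂ᵢ {v : ⟨v, αᵢ⟩ ≥ 0}`. -/
def dominantChamber (n : ℕ) [NeZero n] : Set (V n) :=
  ⋂ i : {i : Fin n // i ≠ 0}, halfPos (simpleRoot i.1) 0

/-- Dominant regions of the `m`-Shi arrangement. -/
def IsDominantRegion (n m : ℕ) [NeZero n] (R : Set (V n)) : Prop :=
  IsRegion (shiArrangement n m) R ∧ R ⊆ dominantChamber n

/-- Alcoves. -/
def IsAlcove (n : ℕ) (A : Set (V n)) : Prop := IsRegion (affineArrangement n) A

/-- The fundamental alcove `A₀`. -/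
def fundamentalAlcove (n : ℕ) [NeZero n] : Set (V n) :=
  interior (halfNeg (theta n) 1 ∩ dominantChamber n)

/-- The hyperplane `⟨v, α⟩ = k` separates `A` and `B`: they lie in different closed half-spaces. -/
def Separates {n : ℕ} (α : V n) (k : ℤ) (A B : Set (V n)) : Prop :=
  (A ⊆ halfPos α k ∧ B ⊆ halfNeg α k) ∨ (A ⊆ halfNeg α k ∧ B ⊆ halfPos α k)

/-- The distance between alcoves: the number of hyperplanes of the affine arrangement separating
them (distinct pairs `(α, k)` with `α > 0` give distinct hyperplanes). -/
def alcoveDist {n : ℕ} (A B : Set (V n)) : ℕ∞ :=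
  Set.encard {p : V n × ℤ | p.1 ∈ posRoots n ∧ Separates p.1 p.2 A B}

/-- `A` is an `m`-minimal alcove of the region `R`: among the alcoves contained in `R` it is
closest to `A₀`. -/
def IsMinimalAlcove (n : ℕ) [NeZero n] (R A : Set (V n)) : Prop :=
  IsAlcove n A ∧ A ⊆ R ∧ ∀ B, IsAlcove n B → B ⊆ R →
    alcoveDist A (fundamentalAlcove n) ≤ alcoveDist B (fundamentalAlcove n)

/-- `H` is a wall of the region `R` of `𝓗`: it belongs to `𝓗` and supports a facet of `R`, i.e.
`closure R ∩ H` affinely spans `H`. -/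
def IsWall {n : ℕ} (𝓗 : Set (Set (V n))) (H R : Set (V n)) : Prop :=
  H ∈ 𝓗 ∧ (affineSpan ℝ (closure R ∩ H) : Set (V n)) = H

/-- The hyperplane `⟨v, α⟩ = k` is a separating wall of the region `R` of the `m`-Shi arrangement:
a wall of `R` that separates `R` from `A₀`. -/
def IsSeparatingWall (n m : ℕ) [NeZero n] (α : V n) (k : ℤ) (R : Set (V n)) : Prop :=
  IsWall (shiArrangement n m) (hyperplane α k) R ∧ Separates α k R (fundamentalAlcove n)

/-! ### The affine symmetric group and its action on `V` -/

/-- The Coxeter matrix of the affine symmetric group on generators `s₀, …, sₙ₋₁` (an entry `0`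
means that there is no relation). -/
def affineMatrix (n : ℕ) [NeZero n] : CoxeterMatrix (Fin n) where
  M := Matrix.of fun i j =>
    if i = j then 1 else if n = 2 then 0 else if i = j + 1 ∨ j = i + 1 then 3 else 2
  isSymm := by
    ext i j
    simp only [Matrix.transpose_apply, Matrix.of_apply, eq_comm (a := i) (b := j),
      or_comm (a := i = j + 1)]
  diagonal := by simp
  off_diagonal := by
    intro i j hij
    simp only [Matrix.of_apply, if_neg hij]
    split_ifs <;> norm_num

/-- The affine symmetric group, given by its Coxeter presentation. -/
abbrev AffSym (n : ℕ) [NeZero n] : Type := (affineMatrix n).Group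

/-- The affine symmetric group with its generators `s₀, …, sₙ₋₁`. -/
abbrev affSystem (n : ℕ) [NeZero n] : CoxeterSystem (affineMatrix n) (AffSym n) :=
  (affineMatrix n).toCoxeterSystem

/-- `0` for `i ≠ 0`, and `-1` for `i = 0`: then `⟨v, simpleRoot i⟩ = reflLevel i` is the hyperplane
`H_{αᵢ,0}` for `i ≠ 0`, and `H_{-θ,-1} = H_{θ,1}` for `i = 0`. -/
def reflLevel {n : ℕ} [NeZero n] (i : Fin n) : ℝ := if i = 0 then -1 else 0

/-- The map of `V` by which `sᵢ` acts: the reflection in `H_{αᵢ,0}` for `i ≠ 0`, and the reflection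
in `H_{θ,1}` for `i = 0`. -/
def reflFun {n : ℕ} [NeZero n] (i : Fin n) (v : V n) : V n :=
  v - (inner ℝ v (simpleRoot i) - reflLevel i) • simpleRoot i

theorem inner_root {n : ℕ} (v : V n) (i j : Fin n) :
    inner ℝ v (root i j) = (v : EuclideanSpace ℝ (Fin n)) i - (v : EuclideanSpace ℝ (Fin n)) j := by
  rw [Submodule.coe_inner]
  simp [root, inner_sub_right, EuclideanSpace.inner_single_right]

theorem root_apply {n : ℕ} (i j k : Fin n) :
    (root i j : EuclideanSpace ℝ (Fin n)) k
      = (if k = i then 1 else 0) - (if k = j then 1 else 0) := by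
  simp [root]

theorem inner_smul_V {n : ℕ} (c : ℝ) (v w : V n) : inner ℝ (c • v) w = c * inner ℝ v w :=
  real_inner_smul_left v w c

theorem sub_one_ne {n : ℕ} [NeZero n] (hn : n ≠ 1) (i : Fin n) : i - 1 ≠ i := by
  intro h
  have h1 : (1 : Fin n) = 0 := sub_eq_self.mp h
  exact hn (Fin.one_eq_zero_iff.mp h1)

theorem inner_simpleRoot_self {n : ℕ} [NeZero n] (hn : n ≠ 1) (i : Fin n) :
    inner ℝ (simpleRoot i) (simpleRoot i) = (2 : ℝ) := by
  have h := sub_one_ne hn i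
  simp only [simpleRoot, inner_root, root_apply, if_true, if_neg h, if_neg h.symm]
  norm_num

theorem simpleRoot_eq_zero (i : Fin 1) : simpleRoot i = 0 := by
  simp [simpleRoot, root]

theorem reflFun_invol {n : ℕ} [NeZero n] (i : Fin n) (v : V n) : reflFun i (reflFun i v) = v := by
  by_cases hn : n = 1
  · subst hn
    simp [reflFun, simpleRoot_eq_zero]
  · have h := inner_simpleRoot_self hn i
    simp only [reflFun, inner_sub_left, inner_smul_V, h]
    module

/-- The reflection by which `sᵢ` acts, as a permutation of `V`. -/
def refl {n : ℕ} [NeZero n] (i : Fin n) : Equiv.Perm (V n) where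
  toFun := reflFun i
  invFun := reflFun i
  left_inv := reflFun_invol i
  right_inv := reflFun_invol i

theorem reflFun_comm {n : ℕ} [NeZero n] {i j : Fin n}
    (h : inner ℝ (simpleRoot i) (simpleRoot j) = (0 : ℝ)) (v : V n) :
    reflFun i (reflFun j v) = reflFun j (reflFun i v) := by
  have h' : inner ℝ (simpleRoot j) (simpleRoot i) = (0 : ℝ) := by rw [real_inner_comm]; exact h
  simp only [reflFun, inner_sub_left, inner_smul_V, h, h']
  module

theorem reflFun_braid {n : ℕ} [NeZero n] (hn : n ≠ 1) {i j : Fin n}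
    (h : inner ℝ (simpleRoot i) (simpleRoot j) = (-1 : ℝ)) (v : V n) :
    reflFun i (reflFun j (reflFun i v)) = reflFun j (reflFun i (reflFun j v)) := by
  have h' : inner ℝ (simpleRoot j) (simpleRoot i) = (-1 : ℝ) := by rw [real_inner_comm]; exact h
  simp only [reflFun, inner_sub_left, inner_smul_V, h, h', inner_simpleRoot_self hn]
  module

theorem inner_simpleRoot_add_one {n : ℕ} [NeZero n] (hn : n ≠ 1) (hn2 : n ≠ 2) (j : Fin n) :
    inner ℝ (simpleRoot (j + 1)) (simpleRoot j) = (-1 : ℝ) := by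
  have h := sub_one_ne hn j
  have h1 : j + 1 ≠ j := by
    have := sub_one_ne hn (j + 1)
    rw [add_sub_cancel_right] at this
    exact this.symm
  have h2 : j - 1 ≠ j + 1 := by
    intro e
    have e2 : (1 : Fin n) + 1 = 0 := by
      have e3 : j = j + (1 + 1) := by
        rw [← add_assoc, ← e, sub_add_cancel]
      exact left_eq_add.mp e3
    have h3 : 3 ≤ n := by
      have := NeZero.ne n
      omega
    have e4 := congrArg Fin.val e2
    rw [Fin.val_add, Fin.val_one', Fin.val_zero, Nat.mod_eq_of_lt (by omega : 1 < n),
      Nat.mod_eq_of_lt (by omega : 1 + 1 < n)] at e4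
    omega
  simp only [simpleRoot, inner_root, root_apply, add_sub_cancel_right, if_true, if_neg h,
    if_neg h1.symm, if_neg h2]
  norm_num

theorem refl_isLiftable (n : ℕ) [NeZero n] :
    (affineMatrix n).IsLiftable (refl : Fin n → Equiv.Perm (V n)) := by
  have hmul (i : Fin n) : (refl i : Equiv.Perm (V n)) * refl i = 1 :=
    Equiv.ext fun v => reflFun_invol i v
  intro i j
  change (refl i * refl j) ^ (if i = j then 1 else if n = 2 then 0
    else if i = j + 1 ∨ j = i + 1 then 3 else 2) = 1
  split_ifs with hij hn hadj
  · rw [hij, pow_one, hmul]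
  · exact pow_zero _
  · have hn1 : n ≠ 1 := by
      rintro rfl
      exact hij (Subsingleton.elim _ _)
    have h : inner ℝ (simpleRoot i) (simpleRoot j) = (-1 : ℝ) := by
      rcases hadj with rfl | rfl
      · exact inner_simpleRoot_add_one hn1 hn j
      · rw [real_inner_comm]
        exact inner_simpleRoot_add_one hn1 hn i
    ext1 v
    change reflFun i (reflFun j (reflFun i (reflFun j (reflFun i (reflFun j v))))) = v
    rw [reflFun_braid hn1 h (reflFun j (reflFun i (reflFun j v))), reflFun_invol, reflFun_invol,
      reflFun_invol]
  · have h : inner ℝ (simpleRoot i) (simpleRoot j) = (0 : ℝ) := by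
      have h1 : i - 1 ≠ j := fun e => hadj (Or.inl (sub_eq_iff_eq_add.mp e))
      have h2 : j - 1 ≠ i := fun e => hadj (Or.inr (sub_eq_iff_eq_add.mp e))
      have h3 : j - 1 ≠ i - 1 := fun e => hij (sub_left_injective e).symm
      simp only [simpleRoot, inner_root, root_apply, if_neg h1.symm, if_neg h2, if_neg h3,
        if_neg (Ne.symm hij)]
      norm_num
    ext1 v
    change reflFun i (reflFun j (reflFun i (reflFun j v))) = v
    rw [reflFun_comm h (reflFun i (reflFun j v)), reflFun_invol, reflFun_invol]

/-- The action of the affine symmetric group on `V`. -/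
def geomAction (n : ℕ) [NeZero n] : AffSym n →* Equiv.Perm (V n) :=
  (affSystem n).lift ⟨refl, refl_isLiftable n⟩

/-- The subgroup `𝔖ₙ` generated by `s₁, …, sₙ₋₁`. -/
def finiteSubgroup (n : ℕ) [NeZero n] : Subgroup (AffSym n) :=
  Subgroup.closure {g | ∃ i : Fin n, i ≠ 0 ∧ g = (affSystem n).simple i}

/-- `w` has minimal length in its coset `w𝔖ₙ`. -/
def IsMinCosetRep (n : ℕ) [NeZero n] (w : AffSym n) : Prop :=
  ∀ u ∈ finiteSubgroup n, (affSystem n).length w ≤ (affSystem n).length (w * u)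

/-! ### Partitions, cores and the action on cores

The box in row `i` and column `j` (counted from `1`) is the cell `(i - 1, j - 1)`. -/

/-- The hook length of the box `c` of `μ`: the number of boxes of `μ` that are `c`, to the right of
`c` in its row, or below `c` in its column. -/
def hookLength (μ : YoungDiagram) (c : ℕ × ℕ) : ℕ :=
  (μ.cells.filter fun d => (d.1 = c.1 ∧ c.2 ≤ d.2) ∨ (d.2 = c.2 ∧ c.1 ≤ d.1)).card

/-- `μ` is an `n`-core. -/
def IsCore (n : ℕ) (μ : YoungDiagram) : Prop := ∀ c ∈ μ, ¬ n ∣ hookLength μ c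

/-- The cell `c` has residue `r` modulo `n`. -/
def HasResidue (n : ℕ) (r : Fin n) (c : ℕ × ℕ) : Prop :=
  (c.2 : ℤ) - (c.1 : ℤ) ≡ ((r : ℕ) : ℤ) [ZMOD (n : ℤ)]

/-- The cell `c` is not in `μ`, and adding it gives a partition. -/
def IsAddable (μ : YoungDiagram) (c : ℕ × ℕ) : Prop :=
  c ∉ μ ∧ IsLowerSet ((insert c μ.cells : Finset (ℕ × ℕ)) : Set (ℕ × ℕ))

/-- The cell `c` is in `μ`, and removing it gives a partition. -/
def IsRemovable (μ : YoungDiagram) (c : ℕ × ℕ) : Prop :=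
  c ∈ μ ∧ IsLowerSet ((μ.cells.erase c : Finset (ℕ × ℕ)) : Set (ℕ × ℕ))

open Classical in
/-- The set of all addable cells of residue `r`, see `mem_addableCells`. -/
def addableCells (n : ℕ) (r : Fin n) (μ : YoungDiagram) : Finset (ℕ × ℕ) :=
  (Finset.range (μ.colLen 0 + 1) ×ˢ Finset.range (μ.rowLen 0 + 1)).filter
    fun c => IsAddable μ c ∧ HasResidue n r c

theorem mem_addableCells {n : ℕ} {r : Fin n} {μ : YoungDiagram} {c : ℕ × ℕ} :
    c ∈ addableCells n r μ ↔ IsAddable μ c ∧ HasResidue n r c := by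
  simp only [addableCells, Finset.mem_filter, Finset.mem_product, Finset.mem_range,
    and_iff_right_iff_imp]
  rintro ⟨⟨hc, hl⟩, -⟩
  obtain ⟨i, j⟩ := c
  constructor
  · by_contra! h
    have hlt : μ.colLen 0 < i := by simp only at h; omega
    have h1 : (μ.colLen 0, 0) ∈ μ := by
      have h2 := hl (show (μ.colLen 0, 0) ≤ (i, j) from ⟨hlt.le, Nat.zero_le _⟩)
        (by simp)
      simp only [Finset.coe_insert, Set.mem_insert_iff, Prod.mk.injEq] at h2
      rcases h2 with h2 | h2
      · omega
      · exact h2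
    exact lt_irrefl _ (YoungDiagram.mem_iff_lt_colLen.mp h1)
  · by_contra! h
    have hlt : μ.rowLen 0 < j := by simp only at h; omega
    have h1 : (0, μ.rowLen 0) ∈ μ := by
      have h2 := hl (show (0, μ.rowLen 0) ≤ (i, j) from ⟨Nat.zero_le _, hlt.le⟩)
        (by simp)
      simp only [Finset.coe_insert, Set.mem_insert_iff, Prod.mk.injEq] at h2
      rcases h2 with h2 | h2
      · omega
      · exact h2
    exact lt_irrefl _ (YoungDiagram.mem_iff_lt_rowLen.mp h1)

open Classical in
/-- The set of all removable cells of residue `r`. -/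
def removableCells (n : ℕ) (r : Fin n) (μ : YoungDiagram) : Finset (ℕ × ℕ) :=
  μ.cells.filter fun c => IsRemovable μ c ∧ HasResidue n r c

theorem mem_removableCells {n : ℕ} {r : Fin n} {μ : YoungDiagram} {c : ℕ × ℕ} :
    c ∈ removableCells n r μ ↔ IsRemovable μ c ∧ HasResidue n r c := by
  simp only [removableCells, Finset.mem_filter, YoungDiagram.mem_cells, and_iff_right_iff_imp]
  exact fun h => h.1.1

/-- Add all addable cells of residue `r`. -/
def addAll (n : ℕ) (r : Fin n) (μ : YoungDiagram) : YoungDiagram where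
  cells := μ.cells ∪ addableCells n r μ
  isLowerSet := by
    intro a b hba ha
    rw [Finset.mem_coe, Finset.mem_union] at ha ⊢
    rcases ha with ha | ha
    · exact Or.inl (μ.isLowerSet hba ha)
    · have h := (mem_addableCells.mp ha).1.2 hba (by simp)
      rw [Finset.mem_coe, Finset.mem_insert] at h
      rcases h with rfl | h
      · exact Or.inr ha
      · exact Or.inl h

/-- Remove all removable cells of residue `r`. -/
def removeAll (n : ℕ) (r : Fin n) (μ : YoungDiagram) : YoungDiagram where
  cells := μ.cells \ removableCells n r μ
  isLowerSet := by
    intro a b hba ha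
    rw [Finset.mem_coe, Finset.mem_sdiff] at ha ⊢
    refine ⟨μ.isLowerSet hba ha.1, fun hb => ?_⟩
    have hab : a ≠ b := by
      rintro rfl
      exact ha.2 hb
    have h := (mem_removableCells.mp hb).1.2 hba
      (Finset.mem_coe.mpr (Finset.mem_erase.mpr ⟨hab, ha.1⟩))
    simp at h

open Classical in
/-- The action of the generator `s_r` on (core) partitions. -/
def coreStep (n : ℕ) (r : Fin n) (μ : YoungDiagram) : YoungDiagram :=
  if (addableCells n r μ).Nonempty then addAll n r μ
  else if (removableCells n r μ).Nonempty then removeAll n r μ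
  else μ

/-- `μ = w∅`: for some expression `w = s_{i₁} ⋯ s_{iₖ}` one has `μ = s_{i₁}(⋯ s_{iₖ}(∅) ⋯)`. -/
def IsOrbitOfEmpty (n : ℕ) [NeZero n] (w : AffSym n) (μ : YoungDiagram) : Prop :=
  ∃ ω : List (Fin n), (affSystem n).wordProd ω = w ∧ μ = ω.foldr (coreStep n) ⊥

/-! ### The map `Φ` -/

/-- `Φ(μ) = A`, where `Φ` is the map `w∅ ↦ w⁻¹A₀`, for `w` of minimal length in `w𝔖ₙ`. -/
def PhiMapsTo (n : ℕ) [NeZero n] (μ : YoungDiagram) (A : Set (V n)) : Prop :=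
  ∃ w : AffSym n, IsMinCosetRep n w ∧ IsOrbitOfEmpty n w μ ∧
    A = geomAction n w⁻¹ '' fundamentalAlcove n

end

end ShiCore

/-!
Let `μ = w∅` and let `q` be the image under `w⁻¹` of the centre of the fundamental alcove. If `φ` is
the affine permutation of `ℤ` given by `w`, then `⟪q, eᵢ - eⱼ⟫ = (φ j - φ i) / n` is never an
integer for `i ≠ j`, hence differs from every integer by at least `1 / n`. So when
`⟪q, α⟫ = k + 1 / n`, one can go from `q` to the hyperplane `⟪v, α⟫ = k` without meeting any other;
in particular `⟪q, θ⟫ = m + 1 / n` makes `H_{θ,m}` a separating wall. Conversely, if `H_{θ,m}` is a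
separating wall, a point of its facet with non-integral `⟪v, β⟫` shows that
`⟪q, γ⟫ < m - ⌊⟪q, β⟫⌋` whenever `θ = β + γ`. Choose `β = root 0 i` with `φ i ≡ φ 0 + 1` modulo `n`:
then `⟪q, β⟫` exceeds its integer part by exactly `1 / n`. If `β ≠ θ`, the inequality gives
`m ≤ ⟪q, θ⟫ < m + 1 / n`, which is impossible; so `β = θ`, and `⟪q, θ⟫ = m + 1 / n` because in a
minimal alcove `⟪q, θ⟫ = k + 1 / n` forces `k ≤ m`.

On the other side, the Maya diagram of `w∅` is the set `φ '' {z | z < 0}`. For a dominant alcove `φ`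
increases on `{0, …, n - 1}`, so that `φ (-1)` is the largest bead, `φ 0` the smallest gap, and the
first hook length is their difference.
-/

namespace ShiCore

open scoped InnerProductSpace Topology AddConstMap

/-! ### Roots and regions -/

section Roots

variable {n : ℕ} {α β : V n}

theorem inner_self_of_mem_posRoots (hα : α ∈ posRoots n) : ⟪α, α⟫_ℝ = 2 := by
  obtain ⟨i, j, hij, rfl⟩ := hα
  rw [inner_root, root_apply, root_apply, if_pos rfl, if_neg hij.ne, if_neg hij.ne', if_pos rfl]
  norm_num

theorem abs_inner_le_one_of_mem_posRoots (hα : α ∈ posRoots n) (hβ : β ∈ posRoots n)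
    (hne : α ≠ β) : |⟪α, β⟫_ℝ| ≤ 1 := by
  obtain ⟨i, j, hij, rfl⟩ := hα
  obtain ⟨k, l, hkl, rfl⟩ := hβ
  have hsame : k = i → l ≠ j := by
    rintro rfl rfl
    exact hne rfl
  have hopp : k = j → l ≠ i := by
    rintro rfl rfl
    exact hij.asymm hkl
  rw [inner_root, root_apply, root_apply]
  split_ifs <;> first | tauto | norm_num

theorem norm_lt_of_mem_posRoots (hα : α ∈ posRoots n) : ‖α‖ < 3 / 2 := by
  rw [norm_eq_sqrt_real_inner, inner_self_of_mem_posRoots hα]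
  exact Real.sqrt_two_lt_three_halves

theorem finite_posRoots (n : ℕ) : (posRoots n).Finite :=
  (Set.finite_range fun p : Fin n × Fin n => root p.1 p.2).subset <| by
    rintro _ ⟨i, j, -, rfl⟩
    exact ⟨(i, j), rfl⟩

theorem root_add_root (i j k : Fin n) : root i j + root j k = root i k :=
  Subtype.ext (sub_add_sub_cancel _ _ _)

/-- The hyperplane `⟪v, α⟫ = c` as an affine subspace. -/
def levelSubspace (α : V n) (c : ℝ) : AffineSubspace ℝ (V n) where
  carrier := {v | ⟪v, α⟫_ℝ = c}
  smul_vsub_vadd_mem' a p₁ p₂ p₃ h₁ h₂ h₃ := by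
    simp only [Set.mem_ofPred_eq, vsub_eq_sub, vadd_eq_add, inner_add_left, inner_sub_left,
      inner_smul_V] at *
    rw [h₁, h₂, h₃]
    ring

theorem coe_levelSubspace (α : V n) (k : ℤ) :
    (levelSubspace α k : Set (V n)) = hyperplane α k := rfl

theorem mem_levelSubspace {c : ℝ} {v : V n} : v ∈ levelSubspace α c ↔ ⟪v, α⟫_ℝ = c := Iff.rfl

end Roots

section SameSide

variable {n : ℕ} {α : V n} {k : ℤ} {x y : V n}

/-- `x` and `y` lie strictly on the same side of the hyperplane `⟪v, α⟫ = k`. -/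
def StrictSameSide (α : V n) (k : ℤ) (x y : V n) : Prop :=
  (k < ⟪x, α⟫_ℝ ∧ k < ⟪y, α⟫_ℝ) ∨ (⟪x, α⟫_ℝ < k ∧ ⟪y, α⟫_ℝ < k)

theorem StrictSameSide.left (h : StrictSameSide α k x y) : StrictSameSide α k x x :=
  h.imp (fun h => ⟨h.1, h.1⟩) fun h => ⟨h.1, h.1⟩

theorem StrictSameSide.inner_right_ne (h : StrictSameSide α k x y) : ⟪y, α⟫_ℝ ≠ k :=
  h.elim (fun h => h.2.ne') fun h => h.2.ne

theorem StrictSameSide.lt_inner (h : StrictSameSide α k x y) (hx : k ≤ ⟪x, α⟫_ℝ) :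
    k < ⟪y, α⟫_ℝ :=
  (h.resolve_right fun h => h.1.not_ge hx).2

theorem StrictSameSide.inner_lt (h : StrictSameSide α k x y) (hx : ⟪x, α⟫_ℝ ≤ k) :
    ⟪y, α⟫_ℝ < k :=
  (h.resolve_left fun h => h.1.not_ge hx).2

theorem StrictSameSide.symm (h : StrictSameSide α k x y) : StrictSameSide α k y x :=
  h.imp And.symm And.symm

theorem convex_setOf_strictSameSide (α : V n) (k : ℤ) (x : V n) :
    Convex ℝ {y | StrictSameSide α k x y} := by
  have hlin : IsLinearMap ℝ fun y : V n => ⟪y, α⟫_ℝ :=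
    ⟨fun v w => inner_add_left v w α, fun c v => inner_smul_V c v α⟩
  rcases lt_trichotomy ⟪x, α⟫_ℝ k with hx | hx | hx
  · have : {y | StrictSameSide α k x y} = {y | ⟪y, α⟫_ℝ < k} := by
      ext y
      simp only [StrictSameSide, hx, hx.not_gt, true_and, false_and, false_or, Set.mem_ofPred_eq]
    exact this ▸ convex_halfSpace_lt hlin k
  · simp only [StrictSameSide, hx, lt_irrefl, false_and, or_self]
    exact convex_empty
  · have : {y | StrictSameSide α k x y} = {y | k < ⟪y, α⟫_ℝ} := by
      ext y
      simp only [StrictSameSide, hx, hx.not_gt, true_and, false_and, or_false, Set.mem_ofPred_eq]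
    exact this ▸ convex_halfSpace_gt hlin k

end SameSide

section Regions

variable {n : ℕ} {𝓗 : Set (Set (V n))} {R : Set (V n)} {α : V n} {k : ℤ} {x y p : V n}

theorem shiArrangement_subset_affineArrangement (n m : ℕ) :
    shiArrangement n m ⊆ affineArrangement n := by
  rintro _ ⟨α, hα, k, -, -, rfl⟩
  exact ⟨α, hα, k, rfl⟩

theorem hyperplane_mem_shiArrangement {m : ℕ} (hα : α ∈ posRoots n) (hk : -(m : ℤ) < k)
    (hkm : k ≤ m) : hyperplane α k ∈ shiArrangement n m :=
  ⟨α, hα, k, hk, hkm, rfl⟩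

theorem hyperplane_mem_affineArrangement (hα : α ∈ posRoots n) (k : ℤ) :
    hyperplane α k ∈ affineArrangement n :=
  ⟨α, hα, k, rfl⟩

namespace IsRegion

theorem strictSameSide (hR : IsRegion 𝓗 R) (hH : hyperplane α k ∈ 𝓗) (hx : x ∈ R) (hy : y ∈ R) :
    StrictSameSide α k x y := by
  obtain ⟨x₀, -, rfl⟩ := hR
  have hne : ∀ v ∈ connectedComponentIn (⋃₀ 𝓗)ᶜ x₀, ⟪v, α⟫_ℝ ≠ k := fun v hv hvk =>
    connectedComponentIn_subset _ _ hv ⟨_, hH, hvk⟩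
  have hlt : ∀ a ∈ connectedComponentIn (⋃₀ 𝓗)ᶜ x₀, ∀ b ∈ connectedComponentIn (⋃₀ 𝓗)ᶜ x₀,
      ⟪a, α⟫_ℝ < k → ⟪b, α⟫_ℝ < k := by
    intro a ha b hb hak
    by_contra! hbk
    obtain ⟨v, hv, hvk⟩ := isPreconnected_connectedComponentIn.intermediate_value ha hb
      (continuous_id.inner continuous_const).continuousOn ⟨hak.le, hbk⟩
    exact hne v hv hvk
  rcases (hne x hx).lt_or_gt with hxk | hxk
  · exact Or.inr ⟨hxk, hlt x hx y hy hxk⟩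
  · exact Or.inl ⟨hxk, (hne y hy).lt_or_gt.resolve_left fun h => hxk.not_gt (hlt y hy x hx h)⟩

theorem subset_halfPos (hR : IsRegion 𝓗 R) (hH : hyperplane α k ∈ 𝓗) (hx : x ∈ R)
    (hxk : k ≤ ⟪x, α⟫_ℝ) : R ⊆ halfPos α k :=
  fun _ hy => ((hR.strictSameSide hH hx hy).lt_inner hxk).le

theorem subset_halfNeg (hR : IsRegion 𝓗 R) (hH : hyperplane α k ∈ 𝓗) (hx : x ∈ R)
    (hxk : ⟪x, α⟫_ℝ ≤ k) : R ⊆ halfNeg α k :=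
  fun _ hy => ((hR.strictSameSide hH hx hy).inner_lt hxk).le

theorem inner_lt_of_mem_closure (hR : IsRegion 𝓗 R) (hH : hyperplane α k ∈ 𝓗)
    (hp : p ∈ closure R) (hpk : ⟪p, α⟫_ℝ < k) (hx : x ∈ R) : ⟪x, α⟫_ℝ < k := by
  have hopen : IsOpen {v : V n | ⟪v, α⟫_ℝ < k} :=
    isOpen_lt (continuous_id.inner continuous_const) continuous_const
  obtain ⟨y, hyk, hyR⟩ := mem_closure_iff.mp hp _ hopen hpk
  exact (hR.strictSameSide hH hyR hx).inner_lt (le_of_lt hyk)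

theorem mem_of_strictSameSide (hR : IsRegion 𝓗 R) (hx : x ∈ R)
    (h : ∀ H ∈ 𝓗, ∃ α k, H = hyperplane α k ∧ StrictSameSide α k x y) : y ∈ R := by
  obtain ⟨x₀, -, rfl⟩ := hR
  rw [connectedComponentIn_eq hx]
  refine (convex_segment x y).isPreconnected.subset_connectedComponentIn
    (left_mem_segment ℝ x y) ?_ (right_mem_segment ℝ x y)
  rintro v hv ⟨H, hH, hvH⟩
  obtain ⟨α, k, rfl, hxy⟩ := h H hH
  have hxv : StrictSameSide α k x v :=
    (convex_setOf_strictSameSide α k x).segment_subset hxy.left hxy hv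
  exact hxv.inner_right_ne hvH

theorem convex (h𝓗 : 𝓗 ⊆ affineArrangement n) (hR : IsRegion 𝓗 R) : Convex ℝ R := by
  refine convex_iff_segment_subset.mpr fun x hx y hy v hv => ?_
  refine hR.mem_of_strictSameSide hx fun H hH => ?_
  obtain ⟨α, -, k, rfl⟩ := h𝓗 hH
  exact ⟨α, k, rfl, (convex_setOf_strictSameSide α k x).segment_subset
    (hR.strictSameSide hH hx hx) (hR.strictSameSide hH hx hy) hv⟩

end IsRegion

end Regions

section AffineSpan

theorem affineSpan_eq_of_mem_nhdsWithin {E : Type*} [AddCommGroup E] [Module ℝ E]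
    [TopologicalSpace E] [ContinuousAdd E] [ContinuousSMul ℝ E] {F : AffineSubspace ℝ E} {S : Set E}
    {p : E} (hp : p ∈ F) (hSF : S ⊆ F) (hS : S ∈ 𝓝[F] p) : affineSpan ℝ S = F := by
  refine le_antisymm (affineSpan_le.mpr hSF) fun h hh => ?_
  have htendsto : Filter.Tendsto (fun t : ℝ => t • (h - p) + p) (𝓝[≠] 0) (𝓝[F] p) := by
    refine tendsto_nhdsWithin_iff.mpr ⟨?_, .of_forall fun t => AffineMap.lineMap_mem t hp hh⟩
    have hcont : Continuous fun t : ℝ => t • (h - p) + p := by fun_prop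
    simpa only [zero_smul, zero_add] using (hcont.tendsto 0).mono_left nhdsWithin_le_nhds
  obtain ⟨t, htS, ht : t ≠ 0⟩ :=
    ((htendsto.eventually hS).and self_mem_nhdsWithin).exists
  have hpS : p ∈ S := mem_of_mem_nhdsWithin hp hS
  have := AffineMap.lineMap_mem t⁻¹ (subset_affineSpan ℝ S hpS) (subset_affineSpan ℝ S htS)
  rwa [AffineMap.lineMap_apply, vsub_eq_sub, vadd_eq_add, add_sub_cancel_right, smul_smul,
    inv_mul_cancel₀ ht, one_smul, sub_add_cancel] at this

end AffineSpan

section Gap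

variable {n : ℕ} {q y α β : V n} {u : ℝ} {k l : ℤ}

/-- No hyperplane `⟪v, α⟫ = k` with `α > 0` and `k ∈ ℤ` comes closer to `q` than `u`, distances
being measured by `|⟪q, α⟫ - k|`. -/
def HasGap (q : V n) (u : ℝ) : Prop :=
  ∀ α ∈ posRoots n, ∀ k : ℤ, u ≤ |⟪q, α⟫_ℝ - k|

theorem HasGap.strictSameSide (hq : HasGap q u) (hβ : β ∈ posRoots n)
    (hy : |⟪y, β⟫_ℝ - ⟪q, β⟫_ℝ| < u) (l : ℤ) : StrictSameSide β l q y := by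
  have hgap := hq β hβ l
  rw [abs_lt] at hy
  rcases le_abs.mp hgap with h | h
  · left; constructor <;> linarith
  · right; constructor <;> linarith

theorem HasGap.le_half (hq : HasGap q u) (hα : α ∈ posRoots n) (hqα : ⟪q, α⟫_ℝ = k + u) :
    u ≤ 1 / 2 := by
  have hgap := hq α hα (k + 1)
  rw [hqα] at hgap
  push_cast at hgap
  rcases le_abs.mp hgap with h | h <;> linarith

theorem HasGap.strictSameSide_of_mem_ball (hq : HasGap q u) (hu : 0 < u) (hα : α ∈ posRoots n)
    (hqα : ⟪q, α⟫_ℝ = k + u) (hy : y ∈ Metric.ball (q - (u / 2) • α) (u / 4))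
    (hβ : β ∈ posRoots n) (hne : (β, l) ≠ (α, k)) : StrictSameSide β l q y := by
  set p := q - (u / 2) • α with hp
  have hyp : |⟪y - p, β⟫_ℝ| < u / 2 :=
    calc |⟪y - p, β⟫_ℝ| ≤ ‖y - p‖ * ‖β‖ := abs_real_inner_le_norm _ _
      _ ≤ u / 4 * (3 / 2) :=
        mul_le_mul (mem_ball_iff_norm.mp hy).le (norm_lt_of_mem_posRoots hβ).le
          (norm_nonneg _) (by positivity)
      _ < u / 2 := by linarith
  have hyβ : ⟪y, β⟫_ℝ = ⟪q, β⟫_ℝ - u / 2 * ⟪α, β⟫_ℝ + ⟪y - p, β⟫_ℝ := by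
    simp only [hp, inner_sub_left, inner_smul_V]
    ring
  by_cases hαβ : α = β
  · subst hαβ
    have hlk : l ≠ k := fun h => hne (by rw [h])
    have := hq.le_half hα hqα
    rw [inner_self_of_mem_posRoots hα, hqα] at hyβ
    rw [abs_lt] at hyp
    rcases hlk.lt_or_gt with h | h
    · have : (l : ℝ) + 1 ≤ k := by exact_mod_cast h
      left; constructor <;> linarith
    · have : (k : ℝ) + 1 ≤ l := by exact_mod_cast h
      right; constructor <;> linarith
  · refine hq.strictSameSide hβ ?_ l
    have := abs_le.mp (abs_inner_le_one_of_mem_posRoots hα hβ hαβ)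
    rw [hyβ, abs_lt]
    rw [abs_lt] at hyp
    constructor <;> nlinarith

theorem HasGap.mem_of_mem_ball {𝓗 : Set (Set (V n))} {R : Set (V n)}
    (h𝓗 : 𝓗 ⊆ affineArrangement n) (hR : IsRegion 𝓗 R) (hqR : q ∈ R) (hq : HasGap q u)
    (hu : 0 < u) (hα : α ∈ posRoots n) (hqα : ⟪q, α⟫_ℝ = k + u)
    (hy : y ∈ Metric.ball (q - (u / 2) • α) (u / 4))
    (hyα : k < ⟪y, α⟫_ℝ) : y ∈ R := by
  refine hR.mem_of_strictSameSide hqR fun H hH => ?_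
  obtain ⟨β, hβ, l, rfl⟩ := h𝓗 hH
  refine ⟨β, l, rfl, ?_⟩
  by_cases hβl : (β, l) = (α, k)
  · obtain ⟨rfl, rfl⟩ := Prod.ext_iff.mp hβl
    exact Or.inl ⟨by linarith, hyα⟩
  · exact hq.strictSameSide_of_mem_ball hu hα hqα hy hβ hβl

theorem HasGap.affineSpan_closure_inter_hyperplane {𝓗 : Set (Set (V n))} {R : Set (V n)}
    (h𝓗 : 𝓗 ⊆ affineArrangement n) (hR : IsRegion 𝓗 R) (hqR : q ∈ R) (hq : HasGap q u)
    (hu : 0 < u) (hα : α ∈ posRoots n) (hqα : ⟪q, α⟫_ℝ = k + u) :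
    (affineSpan ℝ (closure R ∩ hyperplane α k) : Set (V n)) = hyperplane α k := by
  have hαα := inner_self_of_mem_posRoots hα
  have hball : Metric.ball (q - (u / 2) • α) (u / 4) ∩ hyperplane α k ⊆ closure R := by
    rintro y ⟨hy, hyk : ⟪y, α⟫_ℝ = k⟩
    have htendsto : Filter.Tendsto (fun t : ℝ => y + t • α) (𝓝[>] 0) (𝓝 y) := by
      have hcont : Continuous fun t : ℝ => y + t • α := by fun_prop
      simpa only [zero_smul, add_zero] using (hcont.tendsto 0).mono_left nhdsWithin_le_nhds
    refine mem_closure_of_tendsto htendsto ?_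
    filter_upwards [htendsto (Metric.isOpen_ball.mem_nhds hy), self_mem_nhdsWithin]
      with t hty (ht : 0 < t)
    refine hq.mem_of_mem_ball h𝓗 hR hqR hu hα hqα hty ?_
    rw [inner_add_left, inner_smul_V, hαα, hyk]
    linarith
  have hfoot : q - (u / 2) • α ∈ levelSubspace α k := by
    rw [mem_levelSubspace, inner_sub_left, inner_smul_V, hαα, hqα]
    ring
  have hmem : closure R ∩ hyperplane α k ∈ 𝓝[levelSubspace α k] (q - (u / 2) • α) :=
    Filter.mem_of_superset (Filter.inter_mem
      (nhdsWithin_le_nhds (Metric.ball_mem_nhds _ (by positivity))) self_mem_nhdsWithin)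
      fun y hy => ⟨hball hy, hy.2⟩
  rw [affineSpan_eq_of_mem_nhdsWithin (S := closure R ∩ hyperplane α k) hfoot
    Set.inter_subset_right hmem, coe_levelSubspace]

end Gap

section FacetPoint

variable {n : ℕ} {α β : V n} {k : ℤ} {S : Set (V n)}

theorem isDiscrete_range_intCast : IsDiscrete (Set.range ((↑) : ℤ → ℝ)) :=
  Set.image_univ ▸ IsDiscrete.univ.image Int.isClosedEmbedding_coe_real.isInducing

theorem exists_mem_inner_ne_intCast (hS : IsPreconnected S)
    (hspan : (affineSpan ℝ S : Set (V n)) = hyperplane α k) (hα : α ∈ posRoots n)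
    (hβ : β ∈ posRoots n) (hne : α ≠ β) : ∃ p ∈ S, ∀ z : ℤ, ⟪p, β⟫_ℝ ≠ z := by
  by_contra! hint
  have hαα := inner_self_of_mem_posRoots hα
  have hββ := inner_self_of_mem_posRoots hβ
  have hSne : S.Nonempty := by
    rw [← affineSpan_nonempty ℝ, hspan]
    refine ⟨((k : ℝ) / 2) • α, ?_⟩
    rw [hyperplane, Set.mem_ofPred_eq, inner_smul_V, hαα]
    ring
  obtain ⟨p, hp⟩ := hSne
  have hconst : S ⊆ levelSubspace β ⟪p, β⟫_ℝ := fun v hv =>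
    hS.constant_of_mapsTo isDiscrete_range_intCast
      (continuous_id.inner continuous_const).continuousOn
      (fun w hw => (hint w hw).imp fun _ => Eq.symm) hv hp
  set d := (2 : ℝ) • β - ⟪α, β⟫_ℝ • α with hd
  have hdα : ⟪d, α⟫_ℝ = 0 := by
    rw [hd, inner_sub_left, inner_smul_V, inner_smul_V, hαα, real_inner_comm]
    ring
  have hdβ : 0 < ⟪d, β⟫_ℝ := by
    have := abs_le.mp (abs_inner_le_one_of_mem_posRoots hα hβ hne)
    rw [hd, inner_sub_left, inner_smul_V, inner_smul_V, hββ]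
    nlinarith
  have hpα : p ∈ hyperplane α k := hspan ▸ subset_affineSpan ℝ S hp
  have hpd : p + d ∈ (affineSpan ℝ S : Set (V n)) := by
    rw [hspan, hyperplane, Set.mem_ofPred_eq, inner_add_left, hdα, add_zero]
    exact hpα
  have hpdβ := mem_levelSubspace.mp (affineSpan_le.mpr hconst hpd)
  rw [inner_add_left] at hpdβ
  linarith

end FacetPoint

/-! ### Minimal alcoves of dominant regions -/

section HalfSpace

variable {n : ℕ} {v α : V n} {k : ℤ}

theorem mem_interior_halfPos (h : k < ⟪v, α⟫_ℝ) : v ∈ interior (halfPos α k) :=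
  mem_interior.mpr ⟨{w | k < ⟪w, α⟫_ℝ}, fun w (hw : k < ⟪w, α⟫_ℝ) => hw.le,
    isOpen_lt continuous_const (continuous_id.inner continuous_const), h⟩

theorem mem_interior_halfNeg (h : ⟪v, α⟫_ℝ < k) : v ∈ interior (halfNeg α k) :=
  mem_interior.mpr ⟨{w | ⟪w, α⟫_ℝ < k}, fun w (hw : ⟪w, α⟫_ℝ < k) => hw.le,
    isOpen_lt (continuous_id.inner continuous_const) continuous_const, h⟩

end HalfSpace

section AlcoveCenter

/-- The centre of the fundamental alcove, the vector with `⟪v, αᵢ⟫ = 1 / n` for all `i ≠ 0`. -/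
noncomputable def alcoveCenter (n : ℕ) : V n :=
  ⟨WithLp.toLp 2 fun i => ((n - 1) / 2 - (i : ℕ)) / n, by
    change ∑ i : Fin n, ((n - 1 : ℝ) / 2 - (i : ℕ)) / n = 0
    refine self_eq_neg.mp ?_
    rw [← Finset.sum_neg_distrib, ← Equiv.sum_comp Fin.revPerm]
    refine Finset.sum_congr rfl fun i _ => ?_
    rw [Fin.revPerm_apply, Fin.val_rev, Nat.cast_sub i.isLt]
    push_cast
    ring⟩

theorem inner_alcoveCenter_root {n : ℕ} (i j : Fin n) :
    ⟪alcoveCenter n, root i j⟫_ℝ = ((j : ℕ) - (i : ℕ)) / n := by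
  rw [inner_root, alcoveCenter]
  ring

end AlcoveCenter

section DominantChamber

variable {n : ℕ} [NeZero n] {v α : V n}

theorem val_neg_one : ((-1 : Fin n) : ℕ) = n - 1 := by
  obtain ⟨k, rfl⟩ := Nat.exists_eq_succ_of_ne_zero (NeZero.ne n)
  simp

theorem theta_mem_posRoots (hn : 2 ≤ n) : theta n ∈ posRoots n :=
  ⟨0, -1, by rw [Fin.lt_def, val_neg_one, Fin.val_zero]; omega, rfl⟩

theorem simpleRoot_mem_posRoots {i : Fin n} (hi : i ≠ 0) : simpleRoot i ∈ posRoots n := by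
  refine ⟨i - 1, i, ?_, rfl⟩
  have := Fin.val_ne_zero_iff.mpr hi
  rw [Fin.lt_def, Fin.val_sub_one_of_ne_zero hi]
  omega

theorem antitone_of_mem_dominantChamber (hv : v ∈ dominantChamber n) :
    Antitone (v : EuclideanSpace ℝ (Fin n)) := by
  have hstep (i : Fin n) (hi : i ≠ 0) : (v : EuclideanSpace ℝ (Fin n)) i
      ≤ (v : EuclideanSpace ℝ (Fin n)) (i - 1) := by
    have := Set.mem_iInter.mp hv ⟨i, hi⟩
    rwa [halfPos, Set.mem_ofPred_eq, simpleRoot, inner_root, Int.cast_zero, sub_nonneg] at this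
  obtain ⟨k, rfl⟩ := Nat.exists_eq_succ_of_ne_zero (NeZero.ne n)
  refine Fin.antitone_iff_succ_le.mpr fun i => ?_
  have hpred : i.succ - 1 = i.castSucc :=
    Fin.ext (by simp [Fin.val_sub_one_of_ne_zero i.succ_ne_zero])
  exact hpred ▸ hstep i.succ i.succ_ne_zero

theorem inner_nonneg_of_mem_dominantChamber (hv : v ∈ dominantChamber n) (hα : α ∈ posRoots n) :
    0 ≤ ⟪v, α⟫_ℝ := by
  obtain ⟨i, j, hij, rfl⟩ := hα
  rw [inner_root, sub_nonneg]
  exact antitone_of_mem_dominantChamber hv hij.le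

theorem inner_le_inner_theta_of_mem_dominantChamber (hv : v ∈ dominantChamber n)
    (hα : α ∈ posRoots n) : ⟪v, α⟫_ℝ ≤ ⟪v, theta n⟫_ℝ := by
  obtain ⟨i, j, -, rfl⟩ := hα
  rw [theta, inner_root, inner_root]
  refine sub_le_sub (antitone_of_mem_dominantChamber hv (Fin.zero_le i))
    (antitone_of_mem_dominantChamber hv (Fin.le_def.mpr ?_))
  rw [val_neg_one]
  omega

theorem isClosed_dominantChamber : IsClosed (dominantChamber n) :=
  isClosed_iInter fun _ => isClosed_le continuous_const (continuous_id.inner continuous_const)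

theorem fundamentalAlcove_subset_halfNeg (hα : α ∈ posRoots n) {k : ℤ} (hk : 1 ≤ k) :
    fundamentalAlcove n ⊆ halfNeg α k := by
  intro x hx
  obtain ⟨hθ, hdom⟩ := interior_subset hx
  calc ⟪x, α⟫_ℝ ≤ ⟪x, theta n⟫_ℝ := inner_le_inner_theta_of_mem_dominantChamber hdom hα
    _ ≤ (1 : ℤ) := hθ
    _ ≤ k := by exact_mod_cast hk

theorem inner_alcoveCenter_pos (hα : α ∈ posRoots n) : 0 < ⟪alcoveCenter n, α⟫_ℝ := by
  obtain ⟨i, j, hij, rfl⟩ := hα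
  rw [inner_alcoveCenter_root]
  exact div_pos (sub_pos.mpr (by exact_mod_cast hij)) (by exact_mod_cast Nat.pos_of_neZero n)

theorem inner_alcoveCenter_lt_one (hα : α ∈ posRoots n) : ⟪alcoveCenter n, α⟫_ℝ < 1 := by
  obtain ⟨i, j, -, rfl⟩ := hα
  rw [inner_alcoveCenter_root, div_lt_one (by exact_mod_cast Nat.pos_of_neZero n),
    sub_lt_iff_lt_add]
  exact_mod_cast j.isLt.trans_le (Nat.le_add_right n i)

theorem alcoveCenter_mem_fundamentalAlcove (hn : 2 ≤ n) :
    alcoveCenter n ∈ fundamentalAlcove n := by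
  rw [fundamentalAlcove, dominantChamber, interior_inter, interior_iInter_of_finite]
  exact ⟨mem_interior_halfNeg (by simpa using inner_alcoveCenter_lt_one (theta_mem_posRoots hn)),
    Set.mem_iInter.mpr fun i => mem_interior_halfPos
      (by simpa using inner_alcoveCenter_pos (simpleRoot_mem_posRoots i.2))⟩

end DominantChamber

section Distance

variable {n : ℕ} {A B C : Set (V n)} {α β : V n} {k l : ℤ} {x y : V n}

theorem Separates.mem_Icc (h : Separates α k A B) (hx : x ∈ A) (hy : y ∈ B) :
    k ∈ Set.Icc ⌈min ⟪x, α⟫_ℝ ⟪y, α⟫_ℝ⌉ ⌊max ⟪x, α⟫_ℝ ⟪y, α⟫_ℝ⌋ := by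
  rw [Set.mem_Icc, Int.ceil_le, Int.le_floor, min_le_iff, le_max_iff]
  rcases h with ⟨hA, hB⟩ | ⟨hA, hB⟩
  · exact ⟨Or.inr (hB hy), Or.inl (hA hx)⟩
  · exact ⟨Or.inl (hA hx), Or.inr (hB hy)⟩

theorem finite_setOf_separates (hA : A.Nonempty) (hB : B.Nonempty) :
    {p : V n × ℤ | p.1 ∈ posRoots n ∧ Separates p.1 p.2 A B}.Finite := by
  obtain ⟨x, hx⟩ := hA
  obtain ⟨y, hy⟩ := hB
  refine ((finite_posRoots n).biUnion fun α _ => (Set.finite_Icc ⌈min ⟪x, α⟫_ℝ ⟪y, α⟫_ℝ⌉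
    ⌊max ⟪x, α⟫_ℝ ⟪y, α⟫_ℝ⌋).image (Prod.mk α)).subset ?_
  rintro ⟨α, k⟩ ⟨hα, hsep⟩
  exact Set.mem_biUnion hα ⟨k, hsep.mem_Icc hx hy, rfl⟩

theorem IsAlcove.separates_of_strictSameSide (hA : IsAlcove n A) (hα : α ∈ posRoots n)
    (hx : x ∈ A) (hy : y ∈ B) (h : StrictSameSide α k x y) (hsep : Separates α k B C) :
    Separates α k A C := by
  have hH := hyperplane_mem_affineArrangement hα k
  rcases hsep with ⟨hB, hC⟩ | ⟨hB, hC⟩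
  · exact Or.inl ⟨IsRegion.subset_halfPos hA hH hx (h.symm.lt_inner (hB hy)).le, hC⟩
  · exact Or.inr ⟨IsRegion.subset_halfNeg hA hH hx (h.symm.inner_lt (hB hy)).le, hC⟩

theorem IsAlcove.alcoveDist_lt (hA : IsAlcove n A) (hα : α ∈ posRoots n) (hx : x ∈ A)
    (hxk : k < ⟪x, α⟫_ℝ) (hy : y ∈ B) (hyk : ⟪y, α⟫_ℝ < k)
    (hside : ∀ β ∈ posRoots n, ∀ l : ℤ, (β, l) ≠ (α, k) → StrictSameSide β l x y)
    (hC : C ⊆ halfNeg α k) {c : V n} (hc : c ∈ C) (hck : ⟪c, α⟫_ℝ < k) :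
    alcoveDist B C < alcoveDist A C := by
  have hnot : ¬ Separates α k B C := by
    rintro (⟨hB, -⟩ | ⟨-, hC'⟩)
    · exact hyk.not_ge (hB hy)
    · exact hck.not_ge (hC' hc)
  refine (finite_setOf_separates ⟨y, hy⟩ ⟨c, hc⟩).encard_lt_encard
    ((Set.ssubset_iff_of_subset ?_).mpr ⟨(α, k), ⟨hα, ?_⟩, fun h => hnot h.2⟩)
  · rintro ⟨β, l⟩ ⟨hβ, hsep⟩
    have hβl : (β, l) ≠ (α, k) := by
      rintro ⟨⟩
      exact hnot hsep
    exact ⟨hβ, hA.separates_of_strictSameSide hβ hx hy (hside β hβ l hβl) hsep⟩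
  · exact Or.inl ⟨IsRegion.subset_halfPos hA (hyperplane_mem_affineArrangement hα k) hx hxk.le, hC⟩

theorem exists_isAlcove_subset {𝓗 : Set (Set (V n))} {R : Set (V n)} (h𝓗 : 𝓗 ⊆ affineArrangement n)
    (hR : IsRegion 𝓗 R) (hy : y ∈ R) (hyc : y ∉ ⋃₀ affineArrangement n) :
    ∃ B, IsAlcove n B ∧ B ⊆ R ∧ y ∈ B := by
  refine ⟨_, ⟨y, hyc, rfl⟩, ?_, mem_connectedComponentIn hyc⟩
  obtain ⟨x₀, -, rfl⟩ := hR
  rw [connectedComponentIn_eq hy]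
  exact connectedComponentIn_mono y (Set.compl_subset_compl.mpr (Set.sUnion_subset_sUnion h𝓗))

end Distance

section Minimal

variable {n m : ℕ} [NeZero n] {R A : Set (V n)} {q α : V n} {u : ℝ} {k : ℤ}

theorem IsMinimalAlcove.le_of_inner_eq_add (hR : IsRegion (shiArrangement n m) R)
    (hA : IsMinimalAlcove n R A) (hn : 2 ≤ n) (hqA : q ∈ A) (hq : HasGap q u) (hu : 0 < u)
    (hα : α ∈ posRoots n) (hqα : ⟪q, α⟫_ℝ = k + u) : k ≤ m := by
  by_contra! hkm
  obtain ⟨hAlc, hAR, hmin⟩ := hA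
  set y := q - (2 * u / 3) • α with hy
  have hyα : ⟪y, α⟫_ℝ = k - u / 3 := by
    rw [hy, inner_sub_left, inner_smul_V, inner_self_of_mem_posRoots hα, hqα]
    ring
  have hyball : y ∈ Metric.ball (q - (u / 2) • α) (u / 4) := by
    have : y - (q - (u / 2) • α) = -(u / 6) • α := by rw [hy]; module
    rw [mem_ball_iff_norm, this, norm_smul, norm_neg, Real.norm_of_nonneg (by positivity)]
    nlinarith [norm_lt_of_mem_posRoots hα]
  have hside : ∀ β ∈ posRoots n, ∀ l : ℤ, (β, l) ≠ (α, k) → StrictSameSide β l q y :=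
    fun β hβ l hne => hq.strictSameSide_of_mem_ball hu hα hqα hyball hβ hne
  have hyR : y ∈ R := by
    refine hR.mem_of_strictSameSide (hAR hqA) ?_
    rintro _ ⟨β, hβ, l, -, hlm, rfl⟩
    refine ⟨β, l, rfl, hside β hβ l ?_⟩
    rintro ⟨⟩
    exact hkm.not_ge hlm
  have hyc : y ∉ ⋃₀ affineArrangement n := by
    rintro ⟨_, ⟨β, hβ, l, rfl⟩, hyl⟩
    by_cases hβl : (β, l) = (α, k)
    · obtain ⟨rfl, rfl⟩ := Prod.ext_iff.mp hβl
      have : ⟪y, β⟫_ℝ = l := hyl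
      linarith
    · exact (hside β hβ l hβl).inner_right_ne hyl
  obtain ⟨B, hB, hBR, hyB⟩ :=
    exists_isAlcove_subset (shiArrangement_subset_affineArrangement n m) hR hyR hyc
  have hk : 1 ≤ k := by omega
  refine (hmin B hB hBR).not_gt (hAlc.alcoveDist_lt hα hqA (by linarith) hyB (by linarith) hside
    (fundamentalAlcove_subset_halfNeg hα hk) (alcoveCenter_mem_fundamentalAlcove hn) ?_)
  exact (inner_alcoveCenter_lt_one hα).trans_le (by exact_mod_cast hk)

end Minimal

section ThetaWall

variable {n m : ℕ} [NeZero n] {R A : Set (V n)} {α β γ x q : V n} {u : ℝ} {k : ℤ} {i : Fin n}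

theorem IsDominantRegion.inner_lt_sub_floor (hR : IsDominantRegion n m R) (hα : α ∈ posRoots n)
    (hβ : β ∈ posRoots n) (hγ : γ ∈ posRoots n) (hαβγ : β + γ = α)
    (hwall : IsWall (shiArrangement n m) (hyperplane α m) R) (hx : x ∈ R) :
    ⟪x, γ⟫_ℝ < m - ⌊⟪x, β⟫_ℝ⌋ := by
  obtain ⟨hreg, hdom⟩ := hR
  have hne : α ≠ β := by
    rintro rfl
    have := inner_self_of_mem_posRoots hγ
    simp [add_eq_left.mp hαβγ] at this
  have hconv : Convex ℝ (closure R ∩ hyperplane α m) :=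
    (hreg.convex (shiArrangement_subset_affineArrangement n m)).closure.inter
      (levelSubspace α m).convex
  obtain ⟨p, ⟨hpR, hpm : ⟪p, α⟫_ℝ = (m : ℤ)⟩, hpβ⟩ :=
    exists_mem_inner_ne_intCast hconv.isPreconnected hwall.2 hα hβ hne
  have hpdom : p ∈ dominantChamber n := closure_minimal hdom isClosed_dominantChamber hpR
  rw [← hαβγ, inner_add_right, Int.cast_natCast] at hpm
  set k := ⌊⟪p, β⟫_ℝ⌋
  have hkβ : k < ⟪p, β⟫_ℝ := (Int.floor_le _).lt_of_ne (hpβ k).symm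
  have hk0 : 0 ≤ k := Int.floor_nonneg.mpr (inner_nonneg_of_mem_dominantChamber hpdom hβ)
  have hkm : k < m := by
    have := inner_nonneg_of_mem_dominantChamber hpdom hγ
    have : (k : ℝ) < m := by linarith
    exact_mod_cast this
  have hxβ : ⟪x, β⟫_ℝ < (k + 1 : ℤ) :=
    hreg.inner_lt_of_mem_closure (hyperplane_mem_shiArrangement hβ (by omega) (by omega)) hpR
      (by push_cast; exact Int.lt_floor_add_one _) hx
  have hxγ : ⟪x, γ⟫_ℝ < (m - k : ℤ) :=
    hreg.inner_lt_of_mem_closure (hyperplane_mem_shiArrangement hγ (by omega) (by omega)) hpR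
      (by push_cast; linarith) hx
  have hfloor : (⌊⟪x, β⟫_ℝ⌋ : ℝ) ≤ k := by
    exact_mod_cast Int.lt_add_one_iff.mp (Int.floor_lt.mpr hxβ)
  push_cast at hxγ
  linarith

theorem IsSeparatingWall.le_inner (h : IsSeparatingWall n m α k R) (hn : 2 ≤ n)
    (hα : α ∈ posRoots n) (hk : 1 ≤ k) (hx : x ∈ R) : k ≤ ⟪x, α⟫_ℝ := by
  refine h.2.elim (fun h => h.1 hx) fun h => ?_
  have hcenter : k ≤ ⟪alcoveCenter n, α⟫_ℝ := h.2 (alcoveCenter_mem_fundamentalAlcove hn)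
  have hone : (1 : ℝ) ≤ k := by exact_mod_cast hk
  exact absurd (inner_alcoveCenter_lt_one hα) (hone.trans hcenter).not_gt

theorem IsMinimalAlcove.inner_theta_eq_of_isSeparatingWall (hn : 2 ≤ n) (hm : 1 ≤ m)
    (hR : IsDominantRegion n m R) (hA : IsMinimalAlcove n R A) (hqA : q ∈ A) (hu : 0 < u)
    (hq : HasGap q u) (hi : i ≠ 0) (hqi : ⟪q, root 0 i⟫_ℝ = k + u)
    (hwall : IsSeparatingWall n m (theta n) m R) : ⟪q, theta n⟫_ℝ = m + u := by
  have hθ := theta_mem_posRoots hn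
  have hθm : m ≤ ⟪q, theta n⟫_ℝ := by
    exact_mod_cast hwall.le_inner hn hθ (by exact_mod_cast hm) (hA.2.1 hqA)
  have hgap := hq _ hθ m
  rw [Int.cast_natCast, abs_of_nonneg (sub_nonneg.mpr hθm)] at hgap
  have h0i : root 0 i ∈ posRoots n := ⟨0, i, Fin.pos_iff_ne_zero.mpr hi, rfl⟩
  by_cases hilast : i = -1
  · subst hilast
    have hkm := hA.le_of_inner_eq_add hR.1 hn hqA hq hu hθ hqi
    have hu2 := hq.le_half hθ hqi
    have hmk : m ≤ k := by
      rw [theta, hqi] at hθm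
      have : (m : ℝ) < k + 1 := by linarith
      exact_mod_cast Int.lt_add_one_iff.mp (by exact_mod_cast this)
    rw [theta, hqi, le_antisymm hkm hmk, Int.cast_natCast]
  · have hi1 : root i (-1) ∈ posRoots n := by
      refine ⟨i, -1, ?_, rfl⟩
      have := Fin.val_ne_iff.mpr hilast
      rw [val_neg_one] at this
      rw [Fin.lt_def, val_neg_one]
      omega
    have hlt := hR.inner_lt_sub_floor hθ h0i hi1 (root_add_root 0 i (-1)) hwall.1 (hA.2.1 hqA)
    have hfloor : ⌊⟪q, root 0 i⟫_ℝ⌋ = k := by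
      rw [hqi, Int.floor_eq_iff]
      have := hq.le_half h0i hqi
      constructor <;> linarith
    rw [hfloor] at hlt
    rw [theta, ← root_add_root 0 i (-1), inner_add_right, hqi] at hgap
    linarith

theorem IsMinimalAlcove.isSeparatingWall_theta_iff (hn : 2 ≤ n) (hm : 1 ≤ m)
    (hR : IsDominantRegion n m R) (hA : IsMinimalAlcove n R A) (hqA : q ∈ A) (hu : 0 < u)
    (hq : HasGap q u) (hi : i ≠ 0) (hqi : ⟪q, root 0 i⟫_ℝ = k + u) :
    IsSeparatingWall n m (theta n) m R ↔ ⟪q, theta n⟫_ℝ = m + u := by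
  have hθ := theta_mem_posRoots hn
  refine ⟨hA.inner_theta_eq_of_isSeparatingWall hn hm hR hqA hu hq hi hqi, fun h => ?_⟩
  have hH := hyperplane_mem_shiArrangement (m := m) hθ (by omega) le_rfl
  have hqR := hA.2.1 hqA
  refine ⟨⟨hH, hq.affineSpan_closure_inter_hyperplane (shiArrangement_subset_affineArrangement n m)
    hR.1 hqR hu hθ h⟩, Or.inl ⟨hR.1.subset_halfPos hH hqR ?_,
    fundamentalAlcove_subset_halfNeg hθ (by exact_mod_cast hm)⟩⟩
  rw [h, Int.cast_natCast]
  linarith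

end ThetaWall

/-! ### Beads -/

section Beads

variable {n : ℕ} {r : Fin n} {μ : YoungDiagram} {i j : ℕ} {z : ℤ}

/-- The position `λᵢ - i` (rows counted from `1`) of the bead of row `i` of `μ`. -/
def bead (μ : YoungDiagram) (i : ℕ) : ℤ := μ.rowLen i - i - 1

/-- The Maya diagram of `μ`: the set of positions of its beads. -/
def beads (μ : YoungDiagram) : Set ℤ := Set.range (bead μ)

theorem bead_mem_beads (μ : YoungDiagram) (i : ℕ) : bead μ i ∈ beads μ := Set.mem_range_self i

theorem bead_strictAnti (μ : YoungDiagram) : StrictAnti (bead μ) := by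
  intro i j hij
  have := μ.rowLen_anti i j hij.le
  unfold bead
  omega

theorem beads_bot : beads ⊥ = Set.Iio 0 := by
  have hrow (i : ℕ) : (⊥ : YoungDiagram).rowLen i = 0 := by
    by_contra h
    exact YoungDiagram.notMem_bot (i, 0)
      (YoungDiagram.mem_iff_lt_rowLen.mpr (Nat.pos_of_ne_zero h))
  ext z
  simp only [beads, bead, hrow, Set.mem_range, Set.mem_Iio]
  exact ⟨by rintro ⟨i, rfl⟩; omega, fun hz => ⟨(-z - 1).toNat, by omega⟩⟩

theorem bead_add_one_notMem_beads_iff :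
    bead μ i + 1 ∉ beads μ ↔ ∀ i' < i, μ.rowLen i < μ.rowLen i' := by
  constructor
  · intro h i' hi'
    by_contra hlt
    have h1 := μ.rowLen_anti i' (i - 1) (by omega)
    have h2 := μ.rowLen_anti (i - 1) i (by omega)
    exact h ⟨i - 1, by unfold bead; omega⟩
  · rintro h ⟨i', h'⟩
    have hlt : i' < i := (bead_strictAnti μ).lt_iff_gt.mp (by omega)
    have := h i' hlt
    unfold bead at h'
    omega

theorem bead_sub_one_notMem_beads_iff :
    bead μ i - 1 ∉ beads μ ↔ ∀ i' > i, μ.rowLen i' < μ.rowLen i := by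
  constructor
  · intro h i' hi'
    by_contra hlt
    have h1 := μ.rowLen_anti (i + 1) i' (by omega)
    have h2 := μ.rowLen_anti i (i + 1) (by omega)
    exact h ⟨i + 1, by unfold bead; omega⟩
  · rintro h ⟨i', h'⟩
    have hlt : i < i' := (bead_strictAnti μ).lt_iff_gt.mp (by omega)
    have := h i' hlt
    unfold bead at h'
    omega

theorem isAddable_iff {c : ℕ × ℕ} : IsAddable μ c ↔ c ∉ μ ∧ ∀ d < c, d ∈ μ := by
  simp only [IsAddable, Finset.coe_insert]
  refine and_congr_right fun _ => ⟨fun h d hd => ?_, fun h => ?_⟩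
  · exact (h hd.le (Set.mem_insert c _)).resolve_left hd.ne
  · rintro a b hba (rfl | ha)
    · exact hba.eq_or_lt.imp_right (h b)
    · exact Or.inr (μ.isLowerSet hba ha)

theorem isRemovable_iff {c : ℕ × ℕ} : IsRemovable μ c ↔ c ∈ μ ∧ ∀ d > c, d ∉ μ := by
  simp only [IsRemovable, Finset.coe_erase]
  refine and_congr_right fun _ => ⟨fun h d hd hdμ => ?_, fun h a b hba ha => ?_⟩
  · exact (h hd.le ⟨hdμ, hd.ne'⟩).2 rfl
  · refine ⟨μ.isLowerSet hba ha.1, ?_⟩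
    rintro rfl
    exact h a (lt_of_le_of_ne hba (Ne.symm ha.2)) ha.1

theorem isAddable_mk_iff :
    IsAddable μ (i, j) ↔ j = μ.rowLen i ∧ bead μ i + 1 ∉ beads μ := by
  simp only [isAddable_iff, bead_add_one_notMem_beads_iff, Prod.forall, Prod.mk_lt_mk,
    YoungDiagram.mem_iff_lt_rowLen]
  constructor
  · rintro ⟨hj, h⟩
    have hji : j = μ.rowLen i := by
      by_contra hne
      exact lt_irrefl _ (h i (μ.rowLen i) (by omega))
    exact ⟨hji, fun i' hi' => hji ▸ h i' j (by omega)⟩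
  · rintro ⟨rfl, h⟩
    refine ⟨lt_irrefl _, ?_⟩
    rintro a b (⟨ha, hb⟩ | ⟨ha, hb⟩)
    · exact hb.trans_lt (h a ha)
    · exact hb.trans_le (μ.rowLen_anti a i ha)

theorem isRemovable_mk_iff :
    IsRemovable μ (i, j) ↔ j + 1 = μ.rowLen i ∧ bead μ i - 1 ∉ beads μ := by
  simp only [isRemovable_iff, bead_sub_one_notMem_beads_iff, Prod.forall, gt_iff_lt,
    Prod.mk_lt_mk, YoungDiagram.mem_iff_lt_rowLen]
  constructor
  · rintro ⟨hj, h⟩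
    have hji : j + 1 = μ.rowLen i := by
      have := h i (j + 1) (by omega)
      omega
    exact ⟨hji, fun i' hi' => by have := h i' j (by omega); omega⟩
  · rintro ⟨hj, h⟩
    refine ⟨by omega, ?_⟩
    rintro a b (⟨ha, hb⟩ | ⟨ha, hb⟩)
    · have := h a ha
      omega
    · have := μ.rowLen_anti i a ha
      omega

theorem mk_mem_addableCells_iff : (i, j) ∈ addableCells n r μ ↔
    j = μ.rowLen i ∧ bead μ i + 1 ∉ beads μ ∧ bead μ i + 1 ≡ (r : ℕ) [ZMOD n] := by
  rw [mem_addableCells, isAddable_mk_iff, and_assoc]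
  refine and_congr_right fun hj => and_congr_right fun _ => ?_
  rw [HasResidue, bead, sub_add_cancel, hj]

theorem mk_mem_removableCells_iff : (i, j) ∈ removableCells n r μ ↔
    j + 1 = μ.rowLen i ∧ bead μ i - 1 ∉ beads μ ∧ bead μ i ≡ (r : ℕ) [ZMOD n] := by
  rw [mem_removableCells, isRemovable_mk_iff, and_assoc]
  refine and_congr_right fun hj => and_congr_right fun _ => ?_
  rw [HasResidue, bead, ← hj, Nat.cast_add_one, add_sub_right_comm, add_sub_cancel_right]

theorem rowLen_ne_zero_of_bead_sub_one_notMem (h : bead μ i - 1 ∉ beads μ) : μ.rowLen i ≠ 0 :=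
  Nat.ne_zero_of_lt (bead_sub_one_notMem_beads_iff.mp h (i + 1) i.lt_succ_self)

open Classical in
theorem bead_addAll : bead (addAll n r μ) i =
    if bead μ i + 1 ∉ beads μ ∧ bead μ i + 1 ≡ (r : ℕ) [ZMOD n]
      then bead μ i + 1 else bead μ i := by
  have hmem (j : ℕ) : j < (addAll n r μ).rowLen i ↔
      j < μ.rowLen i ∨ (i, j) ∈ addableCells n r μ := by
    rw [← YoungDiagram.mem_iff_lt_rowLen, ← YoungDiagram.mem_iff_lt_rowLen,
      ← YoungDiagram.mem_cells, ← YoungDiagram.mem_cells, ← Finset.mem_union]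
    rfl
  simp only [mk_mem_addableCells_iff] at hmem
  split_ifs with h
  · have : (addAll n r μ).rowLen i = μ.rowLen i + 1 := eq_of_forall_lt_iff fun j => by
      rw [hmem, and_iff_left h, Nat.lt_succ_iff_lt_or_eq]
    simp only [bead, this]
    omega
  · have : (addAll n r μ).rowLen i = μ.rowLen i := eq_of_forall_lt_iff fun j => by
      rw [hmem, or_iff_left fun h' => h h'.2]
    rw [bead, this, bead]

open Classical in
theorem bead_removeAll : bead (removeAll n r μ) i =
    if bead μ i - 1 ∉ beads μ ∧ bead μ i ≡ (r : ℕ) [ZMOD n]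
      then bead μ i - 1 else bead μ i := by
  have hmem (j : ℕ) : j < (removeAll n r μ).rowLen i ↔
      j < μ.rowLen i ∧ (i, j) ∉ removableCells n r μ := by
    rw [← YoungDiagram.mem_iff_lt_rowLen, ← YoungDiagram.mem_iff_lt_rowLen,
      ← YoungDiagram.mem_cells, ← YoungDiagram.mem_cells, ← Finset.mem_sdiff]
    rfl
  simp only [mk_mem_removableCells_iff] at hmem
  split_ifs with h
  · have hne := rowLen_ne_zero_of_bead_sub_one_notMem h.1
    have : (removeAll n r μ).rowLen i = μ.rowLen i - 1 := eq_of_forall_lt_iff fun j => by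
      rw [hmem, and_iff_left h]
      omega
    simp only [bead, this]
    omega
  · have : (removeAll n r μ).rowLen i = μ.rowLen i := eq_of_forall_lt_iff fun j => by
      rw [hmem, and_iff_left fun h' => h h'.2]
    rw [bead, this, bead]

theorem coreStep_of_addableCells_eq_empty (h : addableCells n r μ = ∅) :
    coreStep n r μ = removeAll n r μ := by
  rw [coreStep, if_neg (Finset.not_nonempty_iff_eq_empty.mpr h), ite_eq_left_iff]
  intro h'
  ext1
  rw [Finset.not_nonempty_iff_eq_empty] at h'
  simp only [removeAll, h', Finset.sdiff_empty]

theorem mem_beads_addAll : z ∈ beads (addAll n r μ) ↔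
    (z ∈ beads μ ∧ (z + 1 ≡ (r : ℕ) [ZMOD n] → z + 1 ∈ beads μ)) ∨
      (z - 1 ∈ beads μ ∧ z ∉ beads μ ∧ z ≡ (r : ℕ) [ZMOD n]) := by
  constructor
  · rintro ⟨i, rfl⟩
    rw [bead_addAll]
    split_ifs with h
    · rw [add_sub_cancel_right]
      exact Or.inr ⟨bead_mem_beads μ i, h⟩
    · exact Or.inl ⟨bead_mem_beads μ i, fun hr => by_contra fun hz => h ⟨hz, hr⟩⟩
  · rintro (⟨⟨i, rfl⟩, h⟩ | ⟨⟨i, hi⟩, h⟩)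
    · exact ⟨i, by rw [bead_addAll, if_neg fun h' => h'.1 (h h'.2)]⟩
    · obtain rfl : bead μ i + 1 = z := by omega
      exact ⟨i, by rw [bead_addAll, if_pos h]⟩

theorem mem_beads_removeAll : z ∈ beads (removeAll n r μ) ↔
    (z ∈ beads μ ∧ (z ≡ (r : ℕ) [ZMOD n] → z - 1 ∈ beads μ)) ∨
      (z + 1 ∈ beads μ ∧ z ∉ beads μ ∧ z + 1 ≡ (r : ℕ) [ZMOD n]) := by
  constructor
  · rintro ⟨i, rfl⟩
    rw [bead_removeAll]
    split_ifs with h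
    · rw [sub_add_cancel]
      exact Or.inr ⟨bead_mem_beads μ i, h⟩
    · exact Or.inl ⟨bead_mem_beads μ i, fun hr => by_contra fun hz => h ⟨hz, hr⟩⟩
  · rintro (⟨⟨i, rfl⟩, h⟩ | ⟨⟨i, hi⟩, h⟩)
    · exact ⟨i, by rw [bead_removeAll, if_neg fun h' => h'.1 (h h'.2)]⟩
    · obtain rfl : bead μ i - 1 = z := by omega
      exact ⟨i, by rw [bead_removeAll, if_pos (by simpa using h)]⟩

end Beads

/-! ### Affine permutations -/

section AffinePermutations

variable {n : ℕ} {μ : YoungDiagram} {r : Fin n} {z : ℤ}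

theorem coe_modEq_coe_iff {i r : Fin n} : ((i : ℕ) : ℤ) ≡ (r : ℕ) [ZMOD n] ↔ i = r := by
  rw [Int.natCast_modEq_iff, Nat.ModEq, Nat.mod_eq_of_lt i.isLt, Nat.mod_eq_of_lt r.isLt,
    Fin.ext_iff]

theorem not_modEq_of_add_one_modEq (hn : 2 ≤ n) {a : ℤ} (h : z + 1 ≡ a [ZMOD n]) :
    ¬ z ≡ a [ZMOD n] := by
  intro h'
  have h1 : (n : ℤ) ∣ 1 := by simpa using (h'.trans h.symm).dvd
  have := Int.le_of_dvd one_pos h1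
  omega

/-- The involution of `ℤ` exchanging `z` and `z + 1` whenever `z + 1 ≡ r` modulo `n`. It describes
the generator `s_r` of the affine symmetric group, acting on `ℤ`. -/
def swapFun (n : ℕ) (r : Fin n) (z : ℤ) : ℤ :=
  if z + 1 ≡ (r : ℕ) [ZMOD n] then z + 1 else if z ≡ (r : ℕ) [ZMOD n] then z - 1 else z

theorem swapFun_of_add_one_modEq (h : z + 1 ≡ (r : ℕ) [ZMOD n]) : swapFun n r z = z + 1 :=
  if_pos h

theorem swapFun_of_modEq (hn : 2 ≤ n) (h : z ≡ (r : ℕ) [ZMOD n]) : swapFun n r z = z - 1 := by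
  rw [swapFun, if_neg fun h' => not_modEq_of_add_one_modEq hn h' h, if_pos h]

theorem swapFun_of_not_modEq (h : ¬ z + 1 ≡ (r : ℕ) [ZMOD n]) (h' : ¬ z ≡ (r : ℕ) [ZMOD n]) :
    swapFun n r z = z := by
  rw [swapFun, if_neg h, if_neg h']

theorem swapFun_involutive (hn : 2 ≤ n) (r : Fin n) : Function.Involutive (swapFun n r) := by
  intro z
  by_cases h : z + 1 ≡ (r : ℕ) [ZMOD n]
  · rw [swapFun_of_add_one_modEq h, swapFun_of_modEq hn h, add_sub_cancel_right]
  by_cases h' : z ≡ (r : ℕ) [ZMOD n]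
  · rw [swapFun_of_modEq hn h', swapFun_of_add_one_modEq (by rwa [sub_add_cancel]),
      sub_add_cancel]
  · rw [swapFun_of_not_modEq h h', swapFun_of_not_modEq h h']

theorem swapFun_add (r : Fin n) (z : ℤ) : swapFun n r (z + n) = swapFun n r z + n := by
  simp only [swapFun, add_right_comm z (n : ℤ) 1, Int.add_modulus_modEq_iff]
  split_ifs <;> ring

/-- The affine permutation by which the generator `s_r` acts on `ℤ`. -/
def swap (hn : 2 ≤ n) (r : Fin n) : ℤ ≃+c[(n : ℤ), (n : ℤ)] ℤ where
  __ := (swapFun_involutive hn r).toPerm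
  map_add_const' := swapFun_add r

/-- The affine permutation by which a word in the generators acts on `ℤ`. -/
def affinePerm (hn : 2 ≤ n) (ω : List (Fin n)) : ℤ ≃+c[(n : ℤ), (n : ℤ)] ℤ :=
  (ω.map (swap hn)).prod

theorem map_add_mul (φ : ℤ ≃+c[(n : ℤ), (n : ℤ)] ℤ) (z l : ℤ) :
    φ (z + n * l) = φ z + n * l := by
  simpa only [smul_eq_mul, mul_comm] using AddConstMapClass.map_add_zsmul φ z l

theorem affinePerm_nil (hn : 2 ≤ n) (z : ℤ) : affinePerm hn [] z = z := rfl

theorem affinePerm_cons (hn : 2 ≤ n) (r : Fin n) (ω : List (Fin n)) (z : ℤ) :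
    affinePerm hn (r :: ω) z = swapFun n r (affinePerm hn ω z) := by
  simp only [affinePerm, List.map_cons, List.prod_cons]
  rfl

theorem swapFun_preimage_beads_of_add (hn : 2 ≤ n)
    (h : ∀ z ∈ beads μ, z ≡ (r : ℕ) [ZMOD n] → z - 1 ∈ beads μ) :
    swapFun n r ⁻¹' beads μ = beads (addAll n r μ) := by
  ext z
  rw [Set.mem_preimage, mem_beads_addAll]
  by_cases h1 : z + 1 ≡ (r : ℕ) [ZMOD n]
  · have := h (z + 1)
    rw [add_sub_cancel_right] at this
    have := not_modEq_of_add_one_modEq hn h1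
    rw [swapFun_of_add_one_modEq h1]
    tauto
  by_cases h2 : z ≡ (r : ℕ) [ZMOD n]
  · have := h z
    rw [swapFun_of_modEq hn h2]
    tauto
  · rw [swapFun_of_not_modEq h1 h2]
    tauto

theorem swapFun_preimage_beads_of_remove (hn : 2 ≤ n)
    (h : ∀ z ∈ beads μ, z + 1 ≡ (r : ℕ) [ZMOD n] → z + 1 ∈ beads μ) :
    swapFun n r ⁻¹' beads μ = beads (removeAll n r μ) := by
  ext z
  rw [Set.mem_preimage, mem_beads_removeAll]
  by_cases h1 : z + 1 ≡ (r : ℕ) [ZMOD n]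
  · have := h z
    have := not_modEq_of_add_one_modEq hn h1
    rw [swapFun_of_add_one_modEq h1]
    tauto
  by_cases h2 : z ≡ (r : ℕ) [ZMOD n]
  · have := h (z - 1)
    rw [sub_add_cancel] at this
    rw [swapFun_of_modEq hn h2]
    tauto
  · rw [swapFun_of_not_modEq h1 h2]
    tauto

/-- The bead set is closed under moving a bead `n` places to the left; these are the Maya diagrams
of `n`-cores. -/
def IsFlush (n : ℕ) (B : Set ℤ) : Prop := ∀ z ∈ B, ∀ k : ℕ, z - n * k ∈ B

theorem IsFlush.sub_one_mem {B : Set ℤ} (hB : IsFlush n B) {a y : ℤ} (hy : y ∈ B)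
    (hy1 : y + 1 ∉ B) (hya : y + 1 ≡ a [ZMOD n]) (hz : z ∈ B) (hza : z ≡ a [ZMOD n]) :
    z - 1 ∈ B := by
  obtain ⟨k, hk⟩ := (hza.trans hya.symm).dvd
  rcases le_total 0 k with hk0 | hk0
  · lift k to ℕ using hk0
    have := hB y hy k
    rwa [show y - n * k = z - 1 by linarith] at this
  · obtain ⟨l, rfl⟩ := Int.exists_eq_neg_ofNat hk0
    have := hB z hz l
    rw [show z - n * l = y + 1 by linarith] at this
    exact absurd this hy1

theorem swapFun_preimage_beads (hn : 2 ≤ n) (hB : IsFlush n (beads μ)) (r : Fin n) :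
    swapFun n r ⁻¹' beads μ = beads (coreStep n r μ) := by
  rcases (addableCells n r μ).eq_empty_or_nonempty with hadd | hadd
  · rw [coreStep_of_addableCells_eq_empty hadd]
    refine swapFun_preimage_beads_of_remove hn ?_
    rintro _ ⟨i, rfl⟩ hi
    by_contra hmem
    have hcell := mk_mem_addableCells_iff.mpr ⟨rfl, hmem, hi⟩
    simp only [hadd, Finset.notMem_empty] at hcell
  · rw [coreStep, if_pos hadd]
    obtain ⟨⟨i, j⟩, hij⟩ := hadd
    obtain ⟨-, hi, hir⟩ := mk_mem_addableCells_iff.mp hij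
    exact swapFun_preimage_beads_of_add hn fun z hz hzr =>
      hB.sub_one_mem (bead_mem_beads μ i) hi hir hz hzr

theorem isFlush_of_preimage_eq_Iio {B : Set ℤ} {φ : ℤ ≃+c[(n : ℤ), (n : ℤ)] ℤ}
    (hφ : φ ⁻¹' B = Set.Iio 0) : IsFlush n B := by
  intro y hy k
  obtain ⟨z, rfl⟩ := φ.surjective y
  have hz : z < 0 := by rwa [← Set.mem_Iio, ← hφ, Set.mem_preimage]
  have hle : (0 : ℤ) ≤ n * k := by positivity
  change φ z - n * k ∈ B
  rw [sub_eq_add_neg, ← mul_neg, ← map_add_mul, ← Set.mem_preimage, hφ, Set.mem_Iio]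
  linarith

theorem affinePerm_preimage_beads (hn : 2 ≤ n) (ω : List (Fin n)) :
    affinePerm hn ω ⁻¹' beads (ω.foldr (coreStep n) ⊥) = Set.Iio 0 := by
  induction ω with
  | nil => exact beads_bot
  | cons r ω ih =>
    rw [← ih, List.foldr_cons, ← swapFun_preimage_beads hn (isFlush_of_preimage_eq_Iio ih) r]
    ext z
    rw [Set.mem_preimage, Set.mem_preimage, Set.mem_preimage, affinePerm_cons,
      swapFun_involutive hn r]

end AffinePermutations

/-! ### The first hook length -/

section HookLength

variable {n : ℕ} {μ : YoungDiagram}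

theorem rowLen_pos_iff {i : ℕ} : 0 < μ.rowLen i ↔ i < μ.colLen 0 := by
  rw [← YoungDiagram.mem_iff_lt_rowLen, YoungDiagram.mem_iff_lt_colLen]

theorem hookLength_zero_zero (μ : YoungDiagram) :
    hookLength μ (0, 0) = μ.rowLen 0 + μ.colLen 0 - 1 := by
  have hunion : (μ.cells.filter fun d => (d.1 = 0 ∧ 0 ≤ d.2) ∨ (d.2 = 0 ∧ 0 ≤ d.1)) =
      μ.row 0 ∪ μ.col 0 := by
    ext d
    simp only [Finset.mem_filter, zero_le, and_true, Finset.mem_union, YoungDiagram.mem_row_iff,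
      YoungDiagram.mem_col_iff, YoungDiagram.mem_cells, and_or_left]
  have hinter : μ.row 0 ∩ μ.col 0 = μ.cells.filter fun d => d = (0, 0) := by
    ext ⟨a, b⟩
    simp only [Finset.mem_inter, Finset.mem_filter, YoungDiagram.mem_row_iff,
      YoungDiagram.mem_col_iff, YoungDiagram.mem_cells, Prod.mk.injEq]
    tauto
  have hcard := Finset.card_union_add_card_inter (μ.row 0) (μ.col 0)
  rw [← YoungDiagram.rowLen_eq_card, ← YoungDiagram.colLen_eq_card, hinter,
    Finset.filter_eq'] at hcard
  have hcorner : (0, 0) ∈ μ.cells ↔ 0 < μ.rowLen 0 := YoungDiagram.mem_iff_lt_rowLen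
  have hpos := rowLen_pos_iff (μ := μ) (i := 0)
  rw [hookLength, hunion]
  split_ifs at hcard with h <;> rw [hcorner] at h
  · rw [Finset.card_singleton] at hcard
    omega
  · rw [Finset.card_empty] at hcard
    omega

theorem isGreatest_beads (μ : YoungDiagram) : IsGreatest (beads μ) (μ.rowLen 0 - 1) := by
  refine ⟨⟨0, by simp only [bead, Nat.cast_zero, sub_zero]⟩, ?_⟩
  rintro _ ⟨i, rfl⟩
  have := μ.rowLen_anti 0 i i.zero_le
  unfold bead
  omega

theorem isLeast_compl_beads (μ : YoungDiagram) : IsLeast (beads μ)ᶜ (-μ.colLen 0) := by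
  constructor
  · rintro ⟨i, hi⟩
    have := rowLen_pos_iff (μ := μ) (i := i)
    unfold bead at hi
    omega
  · intro z hz
    by_contra hlt
    have := rowLen_pos_iff (μ := μ) (i := (-z - 1).toNat)
    exact hz ⟨(-z - 1).toNat, by unfold bead; omega⟩

theorem map_eq_map_emod_add (φ : ℤ ≃+c[(n : ℤ), (n : ℤ)] ℤ) (z : ℤ) :
    φ z = φ (z % n) + n * (z / n) := by
  rw [← map_add_mul, Int.emod_add_mul_ediv]

theorem emod_mem_Ico (hn : 0 < n) (z : ℤ) : z % n ∈ Set.Ico (0 : ℤ) n :=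
  ⟨Int.emod_nonneg z (by omega), Int.emod_lt_of_pos z (by omega)⟩

theorem isLeast_compl_of_monotoneOn (hn : 0 < n) {B : Set ℤ} {φ : ℤ ≃+c[(n : ℤ), (n : ℤ)] ℤ}
    (hB : φ ⁻¹' B = Set.Iio 0) (hφ : MonotoneOn φ (Set.Ico (0 : ℤ) n)) :
    IsLeast Bᶜ (φ 0) := by
  have hmem (z : ℤ) : φ z ∈ Bᶜ ↔ 0 ≤ z := by
    rw [Set.mem_compl_iff, ← Set.mem_preimage, hB, Set.mem_Iio, not_lt]
  refine ⟨(hmem 0).mpr le_rfl, fun y hy => ?_⟩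
  obtain ⟨z, rfl⟩ : ∃ z, φ z = y := φ.surjective y
  have hz := (hmem z).mp hy
  calc φ 0 ≤ φ (z % n) := hφ ⟨le_rfl, by omega⟩ (emod_mem_Ico hn z) (emod_mem_Ico hn z).1
    _ ≤ φ (z % n) + n * (z / n) :=
      le_add_of_nonneg_right (mul_nonneg (by omega) (Int.ediv_nonneg hz (by omega)))
    _ = φ z := (map_eq_map_emod_add φ z).symm

theorem isGreatest_of_monotoneOn (hn : 0 < n) {B : Set ℤ} {φ : ℤ ≃+c[(n : ℤ), (n : ℤ)] ℤ}
    (hB : φ ⁻¹' B = Set.Iio 0) (hφ : MonotoneOn φ (Set.Ico (0 : ℤ) n)) :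
    IsGreatest B (φ (-1)) := by
  have hmem (z : ℤ) : φ z ∈ B ↔ z < 0 := by rw [← Set.mem_preimage, hB, Set.mem_Iio]
  refine ⟨(hmem (-1)).mpr (by norm_num), fun y hy => ?_⟩
  obtain ⟨z, rfl⟩ : ∃ z, φ z = y := φ.surjective y
  have hz : z / n ≤ -1 :=
    Int.le_sub_one_of_lt (Int.ediv_neg_of_neg_of_pos ((hmem z).mp hy) (by omega))
  have hlast := emod_mem_Ico hn z
  calc φ z = φ (z % n) + n * (z / n) := map_eq_map_emod_add φ z
    _ ≤ φ (n - 1) + n * (-1) :=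
      add_le_add (hφ hlast (by constructor <;> omega) (Int.le_sub_one_of_lt hlast.2))
        (mul_le_mul_of_nonneg_left hz (by omega))
    _ = φ (-1) := by rw [← map_add_mul]; ring_nf

theorem hookLength_eq_of_monotoneOn (hn : 0 < n) {φ : ℤ ≃+c[(n : ℤ), (n : ℤ)] ℤ}
    (hB : φ ⁻¹' beads μ = Set.Iio 0) (hφ : MonotoneOn φ (Set.Ico (0 : ℤ) n)) :
    hookLength μ (0, 0) = (φ (-1) - φ 0).toNat := by
  have hrow := (isGreatest_beads μ).unique (isGreatest_of_monotoneOn hn hB hφ)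
  have hcol := (isLeast_compl_beads μ).unique (isLeast_compl_of_monotoneOn hn hB hφ)
  rw [hookLength_zero_zero, ← hrow, ← hcol]
  omega

theorem hookLength_eq_mul_add_one_iff (hn : 0 < n) {φ : ℤ ≃+c[(n : ℤ), (n : ℤ)] ℤ}
    (hB : φ ⁻¹' beads μ = Set.Iio 0) (hφ : MonotoneOn φ (Set.Ico (0 : ℤ) n)) {m : ℕ}
    (hm : 1 ≤ m) :
    hookLength μ (0, 0) = n * (m - 1) + 1 ↔ φ (n - 1) = φ 0 + (n * m + 1) := by
  have hlast : φ (n - 1) = φ (-1) + n := by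
    simpa [sub_eq_neg_add] using map_add_mul φ (-1) 1
  rw [hookLength_eq_of_monotoneOn hn hB hφ, hlast, ← Nat.cast_inj (R := ℤ)]
  obtain ⟨k, rfl⟩ := Nat.exists_eq_add_of_le' hm
  rw [Nat.add_sub_cancel]
  push_cast
  rw [mul_add_one]
  have : (0 : ℤ) ≤ n * k := by positivity
  omega

end HookLength

/-! ### Alcoves and affine permutations -/

section AffineExtension

variable {n : ℕ} [NeZero n]

/-- The quasi-periodic function `f` on `ℤ` with `f (z + n) = f z - 1` that extends the coordinates
of `x`. In terms of `f`, the reflection `s_r` is the precomposition with an affine permutation. -/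
noncomputable def affineExtension (x : V n) (z : ℤ) : ℝ :=
  (x : EuclideanSpace ℝ (Fin n)) (Fin.ofNat n (z % n).toNat) - (z / n : ℤ)

theorem affineExtension_add_mul (x : V n) (z l : ℤ) :
    affineExtension x (z + n * l) = affineExtension x z - l := by
  have hn : (n : ℤ) ≠ 0 := by exact_mod_cast NeZero.ne n
  rw [affineExtension, affineExtension, Int.add_mul_emod_self_left, Int.add_mul_ediv_left _ _ hn,
    Int.cast_add, sub_add_eq_sub_sub]

theorem affineExtension_coe (x : V n) (i : Fin n) :
    affineExtension x (i : ℕ) = (x : EuclideanSpace ℝ (Fin n)) i := by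
  have hmod : ((i : ℕ) : ℤ) % n = (i : ℕ) := Int.emod_eq_of_lt (by omega) (by omega)
  have hdiv : ((i : ℕ) : ℤ) / n = 0 := Int.ediv_eq_zero_of_lt (by omega) (by omega)
  rw [affineExtension, hmod, hdiv, Int.toNat_natCast, Fin.ofNat_val_eq_self, Int.cast_zero,
    sub_zero]

theorem exists_eq_coe_add_mul (n : ℕ) [NeZero n] (z : ℤ) :
    ∃ (i : Fin n) (l : ℤ), z = (i : ℕ) + n * l := by
  obtain ⟨h0, hlt⟩ := emod_mem_Ico (Nat.pos_of_neZero n) z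
  exact ⟨⟨(z % n).toNat, by omega⟩, z / n, by rw [Int.toNat_of_nonneg h0, Int.emod_add_mul_ediv]⟩

theorem coe_sub_one_add_one (r : Fin n) :
    (((r - 1 : Fin n) : ℕ) : ℤ) + 1 = (r : ℕ) + n * (if r = 0 then 1 else 0) := by
  have hn := Nat.pos_of_neZero n
  split_ifs with h
  · rw [h, zero_sub, val_neg_one, Fin.val_zero]
    omega
  · have := Fin.val_ne_zero_iff.mpr h
    rw [Fin.val_sub_one_of_ne_zero h]
    omega

theorem coe_add_one_modEq_coe_iff {i r : Fin n} :
    ((i : ℕ) : ℤ) + 1 ≡ (r : ℕ) [ZMOD n] ↔ i = r - 1 := by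
  have h : (((r - 1 : Fin n) : ℕ) : ℤ) + 1 ≡ (r : ℕ) [ZMOD n] := by
    rw [coe_sub_one_add_one]
    exact Int.modEq_add_fac_self
  rw [← coe_modEq_coe_iff]
  exact ⟨fun hi => Int.ModEq.add_right_cancel' 1 (hi.trans h.symm),
    fun hi => (hi.add_right 1).trans h⟩

theorem reflFun_apply (r : Fin n) (x : V n) (i : Fin n) :
    (reflFun r x : EuclideanSpace ℝ (Fin n)) i = (x : EuclideanSpace ℝ (Fin n)) i -
      ((x : EuclideanSpace ℝ (Fin n)) (r - 1) - (x : EuclideanSpace ℝ (Fin n)) r - reflLevel r) *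
        ((if i = r - 1 then 1 else 0) - (if i = r then 1 else 0)) := by
  simp only [reflFun, simpleRoot, inner_root, Submodule.coe_sub, Submodule.coe_smul,
    PiLp.sub_apply, PiLp.smul_apply, root_apply, smul_eq_mul]

theorem affineExtension_reflFun_coe (hn : 2 ≤ n) (r : Fin n) (x : V n) (i : Fin n) :
    affineExtension (reflFun r x) (i : ℕ) = affineExtension x (swapFun n r (i : ℕ)) := by
  have hne := sub_one_ne (by omega : n ≠ 1) r
  have hr := coe_sub_one_add_one r
  rw [affineExtension_coe, reflFun_apply]
  by_cases hpred : i = r - 1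
  · rw [swapFun_of_add_one_modEq (coe_add_one_modEq_coe_iff.mpr hpred), hpred, hr,
      affineExtension_add_mul, affineExtension_coe, if_pos rfl, if_neg hne, reflLevel]
    split_ifs <;> push_cast <;> ring
  by_cases hi : i = r
  · rw [swapFun_of_modEq hn (coe_modEq_coe_iff.mpr hi), hi,
      show ((r : ℕ) : ℤ) - 1 = ((r - 1 : Fin n) : ℕ) + n * -(if r = 0 then 1 else 0) by linarith,
      affineExtension_add_mul, affineExtension_coe, if_pos rfl, if_neg hne.symm, reflLevel]
    split_ifs <;> push_cast <;> ring
  · rw [swapFun_of_not_modEq (mt coe_add_one_modEq_coe_iff.mp hpred)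
      (mt coe_modEq_coe_iff.mp hi), affineExtension_coe, if_neg hpred, if_neg hi]
    ring

theorem affineExtension_refl (hn : 2 ≤ n) (r : Fin n) (x : V n) (z : ℤ) :
    affineExtension (refl r x) z = affineExtension x (swapFun n r z) := by
  obtain ⟨i, l, rfl⟩ := exists_eq_coe_add_mul n z
  have hswap : swapFun n r ((i : ℕ) + n * l) = swapFun n r (i : ℕ) + n * l :=
    map_add_mul (swap hn r) (i : ℕ) l
  rw [hswap, affineExtension_add_mul, affineExtension_add_mul, ← affineExtension_reflFun_coe hn]
  rfl

theorem affineExtension_geomAction (hn : 2 ≤ n) (ω : List (Fin n)) (x : V n) (z : ℤ) :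
    affineExtension (geomAction n ((affSystem n).wordProd ω)⁻¹ x) z =
      affineExtension x (affinePerm hn ω z) := by
  induction ω generalizing x with
  | nil => simp only [CoxeterSystem.wordProd_nil, inv_one, map_one, Equiv.Perm.one_apply,
      affinePerm_nil]
  | cons r ω ih =>
    have hgen : geomAction n ((affSystem n).simple r) = refl r :=
      (affSystem n).lift_apply_simple (refl_isLiftable n) r
    rw [CoxeterSystem.wordProd_cons, mul_inv_rev, CoxeterSystem.inv_simple, map_mul,
      Equiv.Perm.mul_apply, ih, hgen, affinePerm_cons, affineExtension_refl hn]

theorem affineExtension_alcoveCenter_sub (y z : ℤ) :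
    affineExtension (alcoveCenter n) y - affineExtension (alcoveCenter n) z =
      ((z : ℝ) - y) / n := by
  have hn : (n : ℝ) ≠ 0 := NeZero.ne _
  obtain ⟨i, k, rfl⟩ := exists_eq_coe_add_mul n y
  obtain ⟨j, l, rfl⟩ := exists_eq_coe_add_mul n z
  have hij := inner_alcoveCenter_root i j
  rw [inner_root] at hij
  rw [affineExtension_add_mul, affineExtension_add_mul, affineExtension_coe, affineExtension_coe,
    sub_sub_sub_comm, hij]
  push_cast
  field_simp
  ring

end AffineExtension

section AlcoveOfAffinePerm

variable {n : ℕ} {φ : ℤ ≃+c[(n : ℤ), (n : ℤ)] ℤ} {q : V n}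

/-- `q` is the centre of the alcove corresponding to the affine permutation `φ`, expressed by its
inner products with the roots. -/
def IsAlcoveCenter (φ : ℤ ≃+c[(n : ℤ), (n : ℤ)] ℤ) (q : V n) : Prop :=
  ∀ i j : Fin n, ⟪q, root i j⟫_ℝ = ((φ (j : ℕ) - φ (i : ℕ) : ℤ) : ℝ) / n

theorem isAlcoveCenter_geomAction [NeZero n] (hn : 2 ≤ n) (ω : List (Fin n)) :
    IsAlcoveCenter (affinePerm hn ω)
      (geomAction n ((affSystem n).wordProd ω)⁻¹ (alcoveCenter n)) := by
  intro i j
  rw [inner_root, ← affineExtension_coe, ← affineExtension_coe, affineExtension_geomAction hn,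
    affineExtension_geomAction hn, affineExtension_alcoveCenter_sub, Int.cast_sub]

theorem map_coe_sub_map_coe_ne_mul {i j : Fin n} (hij : i ≠ j) (k : ℤ) :
    φ (j : ℕ) - φ (i : ℕ) ≠ n * k := by
  have : NeZero n := ⟨by rintro rfl; exact i.elim0⟩
  intro h
  have hφ : φ (j : ℕ) = φ ((i : ℕ) + n * k) := by rw [map_add_mul]; linarith
  refine hij (coe_modEq_coe_iff.mp ?_)
  rw [φ.injective hφ]
  exact Int.modEq_add_fac_self.symm

namespace IsAlcoveCenter

theorem hasGap (hq : IsAlcoveCenter φ q) : HasGap q (1 / n) := by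
  rintro _ ⟨i, j, hij, rfl⟩ k
  have hn : (0 : ℝ) < n := by exact_mod_cast i.pos
  have hne : φ (j : ℕ) - φ (i : ℕ) - n * k ≠ 0 :=
    sub_ne_zero.mpr (map_coe_sub_map_coe_ne_mul hij.ne k)
  have habs : (1 : ℝ) ≤ |((φ (j : ℕ) - φ (i : ℕ) - n * k : ℤ) : ℝ)| := by
    exact_mod_cast Int.one_le_abs hne
  rw [hq, div_sub' hn.ne', abs_div, abs_of_pos hn]
  exact div_le_div_of_nonneg_right (by exact_mod_cast habs) hn.le

theorem monotoneOn [NeZero n] (hq : IsAlcoveCenter φ q) (hdom : q ∈ dominantChamber n) :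
    MonotoneOn φ (Set.Ico (0 : ℤ) n) := by
  rintro y ⟨hy, hyn⟩ z ⟨hz, hzn⟩ hyz
  lift y to ℕ using hy
  lift z to ℕ using hz
  rcases hyz.eq_or_lt with heq | hlt
  · rw [heq]
  have hnonneg := inner_nonneg_of_mem_dominantChamber hdom
    ⟨⟨y, by omega⟩, ⟨z, by omega⟩, Fin.mk_lt_mk.mpr (by omega), rfl⟩
  rw [hq, le_div_iff₀ (by exact_mod_cast Nat.pos_of_neZero n), zero_mul] at hnonneg
  exact sub_nonneg.mp (by exact_mod_cast hnonneg)

theorem exists_inner_root_zero_eq [NeZero n] (hn : 2 ≤ n) (hq : IsAlcoveCenter φ q) :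
    ∃ i : Fin n, i ≠ 0 ∧ ∃ k : ℤ, ⟪q, root 0 i⟫_ℝ = k + 1 / n := by
  obtain ⟨z, hz⟩ : ∃ z, φ z = φ 0 + 1 := φ.surjective (φ 0 + 1)
  obtain ⟨i, l, rfl⟩ := exists_eq_coe_add_mul n z
  rw [map_add_mul] at hz
  refine ⟨i, ?_, -l, ?_⟩
  · rintro rfl
    rw [Fin.val_zero, Nat.cast_zero, add_right_inj] at hz
    have := Int.le_of_dvd one_pos ⟨l, hz.symm⟩
    omega
  · have hn0 : (n : ℝ) ≠ 0 := NeZero.ne _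
    have hi : φ (i : ℕ) - φ 0 = n * -l + 1 := by linarith
    rw [hq, Fin.val_zero, Nat.cast_zero, hi]
    push_cast
    field_simp

theorem inner_theta_eq_iff [NeZero n] (hq : IsAlcoveCenter φ q) (m : ℕ) :
    ⟪q, theta n⟫_ℝ = m + 1 / n ↔ φ (n - 1) = φ 0 + (n * m + 1) := by
  have hn0 : (n : ℝ) ≠ 0 := NeZero.ne _
  have hlast : ((n - 1 : ℕ) : ℤ) = n - 1 := Nat.cast_pred (Nat.pos_of_neZero n)
  have hrhs : ((m : ℝ) + 1 / n) * n = ((n * m + 1 : ℤ) : ℝ) := by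
    push_cast
    field_simp
  rw [theta, hq, val_neg_one, hlast, Fin.val_zero, Nat.cast_zero, div_eq_iff hn0, hrhs,
    Int.cast_inj, sub_eq_iff_eq_add']

end IsAlcoveCenter

end AlcoveOfAffinePerm

end ShiCore

open ShiCore in
theorem mainTheorem3 (n m : ℕ) [NeZero n] (hn : 2 ≤ n) (hm : 1 ≤ m)
    (R A : Set (ShiCore.V n)) (μ : YoungDiagram)
    (hR : ShiCore.IsDominantRegion n m R)
    (hA : ShiCore.IsMinimalAlcove n R A)
    (hμ : ShiCore.IsCore n μ)
    (hΦ : ShiCore.PhiMapsTo n μ A) :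
    ShiCore.IsSeparatingWall n m (ShiCore.theta n) (m : ℤ) R ↔
      ShiCore.hookLength μ (0, 0) = n * (m - 1) + 1 := by
  obtain ⟨_, -, ⟨ω, rfl, rfl⟩, hAω⟩ := hΦ
  have hn0 : 0 < n := Nat.pos_of_neZero n
  have hq := isAlcoveCenter_geomAction hn ω
  have hqA := hAω ▸ Set.mem_image_of_mem _ (alcoveCenter_mem_fundamentalAlcove hn)
  obtain ⟨i, hi, k, hqi⟩ := hq.exists_inner_root_zero_eq hn
  rw [hA.isSeparatingWall_theta_iff hn hm hR hqA (by positivity) hq.hasGap hi hqi,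
    hq.inner_theta_eq_iff,
    hookLength_eq_mul_add_one_iff hn0 (affinePerm_preimage_beads hn ω)
      (hq.monotoneOn (hR.2 (hA.2.1 hqA))) hm]
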